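/- **Setting.** There are $L$ items $[L]=\{1,\dots,L\}$ and $K\le L$ visible positions. An action is a permutation $a$ of $[L]$; $a(k)$ is the item at position $k$ and $a^{-1}(i)$ the position of item $i$. In each round $t=1,\dots,n$ (with $n\ge 1$) the learner chooses an action $A_t$ and observes click indicators $C_{t1},\dots,C_{tL}\in\{0,1\}$ such that, conditionally on the past rounds and on $A_t=a$, item $i$ is clicked with probability $v(a,a^{-1}(i))$, where $v$ is a function with values in $[0,1]$; nothing else is assumed about the joint law of the clicks. The $n$-step regret is $$R_n = n\max_{a}\sum_{k=1}^K v(a,k)-\mathbb E\Big[\sum_{t=1}^n\sum_{i=1}^L C_{ti}\Big].$$ **Assumptions.** There is $\alpha:[L]\to[0,1]$ such that the following hold, where an action $a$ is called optimal if $\alpha(a(k))=\max_{k'\ge k}\alpha(a(k'))$ for all $k\in[K]$. 1. $v(a,k)=0$ for all actions $a$ and all $k>K$. 2. If $a^*$ is optimal, then $\max_a\sum_{k=1}^K v(a,k)=\sum_{k=1}^K v(a^*,k)$. 3. If $\alpha(i)\ge\alpha(j)$ and $\sigma$ is the permutation of the items that exchanges $i$ and $j$, then $\alpha(j)\,v(a,a^{-1}(i))\ge\alpha(i)\,v(\sigma\circ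 a,a^{-1}(i))$ for every action $a$. 4. If $a^*$ is optimal and $a$ is an action with $\alpha(a(k))=\alpha(a^*(k))$, then $v(a,k)\ge v(a^*,k)$. **Algorithm TopRank** with parameter $\delta$. Let $c=4\sqrt{2/\pi}/\operatorname{erf}(\sqrt2)$ and $G_1=\emptyset$. For a relation $G\subseteq[L]^2$ and $X\subseteq[L]$ let $\min_G(X)=\{i\in X:(i,j)\notin G\text{ for all }j\in X\}$. In round $t$ the items are partitioned into blocks $\mathcal P_{t1},\mathcal P_{t2},\dots$ by $\mathcal P_{td}=\min_{G_t}([L]\setminus\bigcup_{e<d}\mathcal P_{te})$ until no item is left, and $A_t$ is chosen uniformly at random among the actions that place the items of each block before the items of the next one. After observing the clicks let $U_{tij}=C_{ti}-C_{tj}$ if $i$ and $j$ are in the same block and $U_{tij}=0$ otherwise, $S_{tij}=\sum_{s\le t}U_{sij}$ and $N_{tij}=\sum_{s\le t}|U_{sij}|$, and $$G_{t+1}=G_t\cup\Big\{(j,i):S_{tij}\ge\sqrt{2N_{tij}\log\big(\tfrac c\delta\sqrt{N_{tij}}\big)}\text{ and }N_{tij}>0\Big\}.$$ If $G_t$ contains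 a cycle, the algorithm may behave arbitrarily from then on. **Theorem 1.** Let $v$ satisfy Assumptions 1–4 with $\alpha(1)>\alpha(2)>\dots>\alpha(L)$, let $\Delta_{ij}=\alpha(i)-\alpha(j)$ and $\delta\in(0,1)$. Then the $n$-step regret of TopRank satisfies $$R_n\le\delta nKL^2+\sum_{j=1}^L\sum_{i=1}^{\min\{K,j-1\}}\left(1+\frac{6(\alpha(i)+\alpha(j))\log(c\sqrt n/\delta)}{\Delta_{ij}}\right)$$ and $$R_n\le\delta nKL^2+KL+\sqrt{4K^3Ln\log(c\sqrt n/\delta)}.$$ Consequently, for $\delta=1/n$, $$R_n=O\Big(\sum_{j=1}^L\sum_{i=1}^{\min\{K,j-1\}}\frac{\alpha(i)\log n}{\Delta_{ij}}\Big)\quad\text{and}\quad R_n=O\big(\sqrt{K^3Ln\log n}\big)\qquad(n\to\infty),$$ where the implied constants are universal and both estimates hold for all $n\ge n_0$, with $n_0$ depending only on $K$ and $L$. -/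

import Mathlib

noncomputable section

namespace TopRank

open scoped Classical

/-- Actions are rankings: `a k` is the item placed at position `k`, and `a.symm i` is the position
of item `i`.  Items and positions are both indexed from `0`, i.e. by `Fin L`. -/
abbrev Action (L : ℕ) := Equiv.Perm (Fin L)

/-- Click indicators: `c i = true` iff item `i` is clicked. -/
abbrev Clicks (L : ℕ) := Fin L → Bool

/-- What is observed in one round: the action and the click indicators. -/
abbrev Round (L : ℕ) := Action L × Clicks L

/-- The observations of the first `t` rounds. -/
abbrev History (L t : ℕ) := Fin t → Round L

/-- The numerical value `0` or `1` of a click indicator. -/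
def click (b : Bool) : ℤ := if b then 1 else 0

/-- The number of clicked items. -/
def totalClicks {L : ℕ} (c : Clicks L) : ℤ := ∑ i, click (c i)

/-! ### The click function and the modelling assumptions -/

/-- `∑_{k = 1}^K v(a, k)`, the expected number of clicks in the first `K` positions. -/
def value {L : ℕ} (K : ℕ) (v : Action L → Fin L → ℝ) (a : Action L) : ℝ :=
  ∑ k : Fin L with k.val < K, v a k

/-- `max_a ∑_{k = 1}^K v(a, k)`. -/
def maxValue {L : ℕ} (K : ℕ) (v : Action L → Fin L → ℝ) : ℝ :=
  Finset.univ.sup' Finset.univ_nonempty (value K v)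

/-- Action `a` is optimal if `α(a(k)) = max_{k' ≥ k} α(a(k'))` for each of the first `K`
positions `k`. -/
def IsOptimal {L : ℕ} (K : ℕ) (α : Fin L → ℝ) (a : Action L) : Prop :=
  ∀ k : Fin L, (k : ℕ) < K → ∀ k' : Fin L, k ≤ k' → α (a k') ≤ α (a k)

/-- The modelling assumptions on the click function `v` with attractiveness function `α`. -/
structure Assumptions {L : ℕ} (K : ℕ) (α : Fin L → ℝ) (v : Action L → Fin L → ℝ) : Prop where
  /-- `α` takes values in `[0, 1]`. -/
  attractiveness_mem : ∀ i, α i ∈ Set.Icc (0 : ℝ) 1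
  /-- `v` takes values in `[0, 1]`. -/
  click_mem : ∀ a k, v a k ∈ Set.Icc (0 : ℝ) 1
  /-- Items that are not shown are not clicked. -/
  zero : ∀ a (k : Fin L), K ≤ (k : ℕ) → v a k = 0
  /-- Optimal actions maximise the expected number of clicks. -/
  optimal : ∀ a, IsOptimal K α a → maxValue K v = value K v a
  /-- If `α(i) ≥ α(j)` and `σ` exchanges `i` and `j`, then
  `v(a, a⁻¹(i)) ≥ (α(i) / α(j)) v(σ ∘ a, a⁻¹(i))`.  The inequality is multiplied by `α(j)`, so that
  for `α(i) > α(j) = 0`, where the ratio is infinite, it says `v(σ ∘ a, a⁻¹(i)) = 0`. -/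
  exchange : ∀ i j, α j ≤ α i → ∀ a : Action L,
    α i * v (Equiv.swap i j * a) (a.symm i) ≤ α j * v a (a.symm i)
  /-- A position is clicked least under an optimal action, among the actions that put an equally
  attractive item there. -/
  lowest : ∀ a aopt, IsOptimal K α aopt → ∀ k, α (a k) = α (aopt k) → v aopt k ≤ v a k

/-! ### Users -/

/-- A user: the conditional law of the click indicators of a round given the past rounds and the
action of the round. -/
abbrev User (L : ℕ) := ∀ t : ℕ, History L t → Action L → PMF (Clicks L)

/-- Item `i` is clicked with conditional probability `v(a, a⁻¹(i))` given the past and the action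
`a`.  Nothing is assumed about the joint law of the click indicators of a round beyond this. -/
def User.HasClickFunction {L : ℕ} (user : User L) (v : Action L → Fin L → ℝ) : Prop :=
  ∀ (t : ℕ) (h : History L t) (a : Action L) (i : Fin L),
    ((user t h a).map (fun c => c i) true).toReal = v a (a.symm i)

/-! ### The algorithm -/

/-- A learner: the conditional law of the next action given the past rounds. -/
abbrev Policy (L : ℕ) := ∀ t : ℕ, History L t → PMF (Action L)

/-- The error function. -/
def erf (x : ℝ) : ℝ := 2 / √Real.pi * ∫ u in (0 : ℝ)..x, Real.exp (-u ^ 2)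

/-- The constant `c` of the algorithm. -/
def c : ℝ := 4 * √(2 / Real.pi) / erf (√2)

/-- `min_G(X)`, the set of items of `X` from which no arrow of `G` leads to an item of `X`. -/
def minElements {L : ℕ} (G : Set (Fin L × Fin L)) (X : Finset (Fin L)) : Finset (Fin L) :=
  {i ∈ X | ∀ j ∈ X, (i, j) ∉ G}

/-- The items that remain after `d` blocks have been peeled off. -/
def remaining {L : ℕ} (G : Set (Fin L × Fin L)) : ℕ → Finset (Fin L)
  | 0 => Finset.univ
  | d + 1 => remaining G d \ minElements G (remaining G d)

/-- The block with (zero-based) number `d`; it is empty once no items remain. -/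
def block {L : ℕ} (G : Set (Fin L × Fin L)) (d : ℕ) : Finset (Fin L) :=
  minElements G (remaining G d)

/-- Items `i` and `j` are in the same block. -/
def SameBlock {L : ℕ} (G : Set (Fin L × Fin L)) (i j : Fin L) : Prop :=
  ∃ d, i ∈ block G d ∧ j ∈ block G d

/-- The actions that place the items of each block before those of the next one. -/
def blockActions {L : ℕ} (G : Set (Fin L × Fin L)) : Finset (Action L) :=
  {a | ∀ d, ∀ i ∈ block G d, ∀ j ∈ block G (d + 1), a.symm i ≤ a.symm j}

/-- `G` has no cycles. -/
def Acyclic {L : ℕ} (G : Set (Fin L × Fin L)) : Prop :=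
  ∀ i, ¬ Relation.TransGen (fun x y => (x, y) ∈ G) i i

theorem minElements_nonempty {L : ℕ} {G : Set (Fin L × Fin L)} (hG : Acyclic G)
    {X : Finset (Fin L)} (hX : X.Nonempty) : (minElements G X).Nonempty := by
  have : IsTrans (Fin L) (Relation.TransGen (fun x y => (y, x) ∈ G)) :=
    ⟨fun _ _ _ h1 h2 => h1.trans h2⟩
  have : Std.Irrefl (Relation.TransGen (fun x y : Fin L => (y, x) ∈ G)) :=
    ⟨fun i h => hG i (Relation.transGen_swap.1 h)⟩
  have wf := Finite.wellFounded_of_trans_of_irrefl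
    (Relation.TransGen (fun x y : Fin L => (y, x) ∈ G))
  obtain ⟨m, hm, hmin⟩ := wf.has_min (X : Set (Fin L)) hX
  refine ⟨m, ?_⟩
  simp only [minElements, Finset.mem_filter]
  exact ⟨hm, fun j hj hmem => hmin j hj (.single hmem)⟩

theorem exists_mem_block {L : ℕ} {G : Set (Fin L × Fin L)} (hG : Acyclic G) (i : Fin L) :
    ∃ d, i ∈ block G d := by
  by_contra! hi
  have key : ∀ d, i ∈ remaining G d ∧ (remaining G d).card + d ≤ L := by
    intro d
    induction d with
    | zero => simp [remaining]
    | succ d ih =>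
      have hmem : i ∈ remaining G (d + 1) := by
        simp only [remaining, Finset.mem_sdiff]
        exact ⟨ih.1, hi d⟩
      refine ⟨hmem, ?_⟩
      have hlt : (remaining G (d + 1)).card < (remaining G d).card := by
        apply Finset.card_lt_card
        simp only [remaining]
        exact Finset.sdiff_ssubset (Finset.filter_subset _ _) (minElements_nonempty hG ⟨i, ih.1⟩)
      have := ih.2
      omega
  have h1 := (key L).2
  have h2 := Finset.card_pos.2 ⟨i, (key L).1⟩
  omega

theorem remaining_anti {L : ℕ} (G : Set (Fin L × Fin L)) : Antitone (remaining G) :=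
  antitone_nat_of_succ_le fun _ => Finset.sdiff_subset

theorem eq_of_mem_block {L : ℕ} {G : Set (Fin L × Fin L)} {i : Fin L} {d e : ℕ}
    (hd : i ∈ block G d) (he : i ∈ block G e) : d = e := by
  have aux : ∀ d e : ℕ, i ∈ block G d → i ∈ block G e → ¬ d < e := by
    intro d e hd he hlt
    have h1 : i ∈ remaining G (d + 1) :=
      remaining_anti G hlt (Finset.filter_subset _ _ he)
    simp only [remaining, Finset.mem_sdiff] at h1
    exact h1.2 hd
  have h1 := aux d e hd he
  have h2 := aux e d he hd
  omega

theorem blockActions_nonempty {L : ℕ} {G : Set (Fin L × Fin L)} (hG : Acyclic G) :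
    (blockActions G).Nonempty := by
  choose D hD using exists_mem_block hG
  refine ⟨Tuple.sort D, ?_⟩
  simp only [blockActions, Finset.mem_filter, Finset.mem_univ, true_and]
  intro d i hi j hj
  have h1 : D i = d := eq_of_mem_block (hD i) hi
  have h2 : D j = d + 1 := eq_of_mem_block (hD j) hj
  by_contra hlt
  have := Tuple.monotone_sort D (le_of_lt (not_le.1 hlt))
  simp only [Function.comp_apply, Equiv.apply_symm_apply] at this
  omega

/-- The variables of the algorithm between two rounds: the relation `G_{t + 1}` and the statistics
`S_t` and `N_t`. -/
structure State (L : ℕ) where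
  /-- The relation; `(j, i) ∈ G` means that item `i` is believed to be better than item `j`. -/
  G : Set (Fin L × Fin L)
  /-- The sums `S_{tij}` of `U_{sij}`. -/
  S : Fin L → Fin L → ℤ
  /-- The sums `N_{tij}` of `|U_{sij}|`. -/
  N : Fin L → Fin L → ℤ

/-- `U_{tij}`, where `G` is the relation `G_t` and `x` holds the click indicators `C_t`. -/
def clickDiff {L : ℕ} (G : Set (Fin L × Fin L)) (x : Clicks L) (i j : Fin L) : ℤ :=
  if SameBlock G i j then click (x i) - click (x j) else 0

/-- The pairs `(j, i)` that the statistics `S`, `N` put into the relation. -/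
def newPairs {L : ℕ} (δ : ℝ) (S N : Fin L → Fin L → ℤ) : Set (Fin L × Fin L) :=
  {p | (S p.2 p.1 : ℝ) ≥ √(2 * N p.2 p.1 * Real.log (c / δ * √(N p.2 p.1))) ∧ N p.2 p.1 > 0}

/-- The update at the end of a round with click indicators `x`. -/
def State.update {L : ℕ} (δ : ℝ) (s : State L) (x : Clicks L) : State L :=
  let S' : Fin L → Fin L → ℤ := fun i j => s.S i j + clickDiff s.G x i j
  let N' : Fin L → Fin L → ℤ := fun i j => s.N i j + |clickDiff s.G x i j|
  { G := s.G ∪ newPairs δ S' N', S := S', N := N' }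

/-- The variables of the algorithm after `t` rounds with given observations. -/
def state {L : ℕ} (δ : ℝ) : ∀ t : ℕ, History L t → State L
  | 0, _ => { G := ∅, S := fun _ _ => 0, N := fun _ _ => 0 }
  | t + 1, h => (state δ t (Fin.init h)).update δ (h (Fin.last t)).2

/-- The algorithm `TopRank` with parameter `δ`: it plays uniformly at random among the rankings
that respect the blocks of the current relation.  Its behaviour from the moment when the relation
has a cycle on is given by an arbitrary policy `fallback`. -/
def topRank {L : ℕ} (δ : ℝ) (fallback : Policy L) : Policy L := fun t h =>
  if hG : Acyclic (state δ t h).G then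
    PMF.uniformOfFinset (blockActions (state δ t h).G) (blockActions_nonempty hG)
  else fallback t h

/-! ### Interaction and regret -/

/-- The law of the observations of `t` rounds in which a learner interacts with a user. -/
def law {L : ℕ} (user : User L) (π : Policy L) : ∀ t : ℕ, PMF (History L t)
  | 0 => PMF.pure Fin.elim0
  | t + 1 => (law user π t).bind fun h => (π t h).bind fun a =>
      (user t h a).map fun x => Fin.snoc (α := fun _ => Round L) h (a, x)

/-- The expectation of a function on a finite type. -/
def expectation {X : Type*} [Fintype X] (p : PMF X) (f : X → ℝ) : ℝ :=
  ∑ x, (p x).toReal * f x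

/-- The `n`-step regret
`n max_a ∑_{k = 1}^K v(a, k) - 𝔼[∑_{t = 1}^n ∑_{i = 1}^L C_{ti}]`. -/
def regret {L : ℕ} (K : ℕ) (v : Action L → Fin L → ℝ) (user : User L) (π : Policy L) (n : ℕ) : ℝ :=
  n * maxValue K v
    - expectation (law user π n) fun h => ∑ t : Fin n, (totalClicks (h t).2 : ℝ)

end TopRank

end

/-!
With `α` strictly decreasing, item `i` is better than item `j` exactly when `i < j`.

*One round.* Suppose that the relation `G` contains no wrong arrow (`Sound G`). Exchanging two items
of a block permutes the admissible actions, so the exchange assumption, averaged over the actions,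
gives `α i * E[C_j] ≤ α j * E[C_i]` for `i < j` in a common block (`mul_meanClick_le`). Hence the
mean of `U_ij` is at least `relGap α i j = (α i - α j) / (α i + α j)` times the mean of `|U_ij|`.
Moreover, the index of the best item of a block is at most every position of the block
(`exists_leader`), so such a position is clicked, when this item is put there, at least as often as
under the optimal ranking (`click_one_le`). Therefore the regret of the round is at most the sum of
the means of `U_ij` over the pairs `i < j`, `i < K` (`value_sub_sum_meanClick_le`).

*Failures.* By the drift inequality and Hoeffding's lemma, `exp (l D - l ^ 2 N / 2)` with `N = N_ij`
and `D = relGap α i j * N_ij - S_ij` is a supermartingale for `l ≥ 0` while the relation is sound.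
Mixing over `l` uniform on `[0, 2]` and applying Ville's inequality bounds by `δ / 2` the
probability that `D` ever reaches the confidence width of the algorithm (`expectation_failed_le`);
the constant `c` is what the Gaussian integral in the mixture gives (`two_mul_exp_le_mixture`). A
wrong arrow needs such a deviation (`Good.sound`), so the relation is sound until the first one.

*Counting.* Before the first deviation, items `i < j` are compared only while the arrow `(j, i)` is
missing, that is, while `S_ij` is below the confidence width. Since `S_ij` is also at least its
drift minus that width, `S_ij` is at most `1 + 4 log (c √n / δ) / relGap α i j`, and at most
`1 + √(2 N_ij log (c √n / δ))` (`stoppedSum_le`). Summing the first estimate gives the gap-dependent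
bound. For the second, the uniform choice within blocks limits the expected sum of the `N_ij`
over `i < j`, `i < K` to `2 K ^ 2` per round (`sum_roundMean_abs_clickDiff_le`), and the inequality
of arithmetic and geometric means turns this into the gap-free bound.

For `δ = 1 / n` the failure term does not depend on `n`. It is kept proportional to `L * (L - 1)`,
because for `L = 1` the gap-dependent sum is empty and the regret has to vanish.
-/

noncomputable section

namespace TopRank

open scoped Classical

/-! ### Finite expectations -/

section Expectation

variable {X Y : Type*} [Fintype X] [Fintype Y]

theorem sum_toReal_eq_one (p : PMF X) : ∑ x, (p x).toReal = 1 := by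
  rw [← ENNReal.toReal_sum (fun x _ => p.apply_ne_top x), ← tsum_fintype (L := .unconditional _),
    p.tsum_coe, ENNReal.toReal_one]

theorem expectation_const (p : PMF X) (r : ℝ) : expectation p (fun _ => r) = r := by
  simp only [expectation, ← Finset.sum_mul, sum_toReal_eq_one, one_mul]

theorem expectation_add (p : PMF X) (f g : X → ℝ) :
    expectation p (fun x => f x + g x) = expectation p f + expectation p g := by
  simp only [expectation, mul_add, Finset.sum_add_distrib]

theorem expectation_sub (p : PMF X) (f g : X → ℝ) :
    expectation p (fun x => f x - g x) = expectation p f - expectation p g := by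
  simp only [expectation, mul_sub, Finset.sum_sub_distrib]

theorem expectation_const_mul (p : PMF X) (r : ℝ) (f : X → ℝ) :
    expectation p (fun x => r * f x) = r * expectation p f := by
  simp only [expectation, Finset.mul_sum]
  exact Finset.sum_congr rfl fun x _ => by ring

theorem expectation_sum {ι : Type*} (p : PMF X) (s : Finset ι) (f : ι → X → ℝ) :
    expectation p (fun x => ∑ i ∈ s, f i x) = ∑ i ∈ s, expectation p (f i) := by
  simp only [expectation, Finset.mul_sum]
  exact Finset.sum_comm

theorem expectation_mono (p : PMF X) {f g : X → ℝ} (h : ∀ x, f x ≤ g x) :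
    expectation p f ≤ expectation p g :=
  Finset.sum_le_sum fun x _ => mul_le_mul_of_nonneg_left (h x) ENNReal.toReal_nonneg

theorem expectation_nonneg (p : PMF X) {f : X → ℝ} (h : ∀ x, 0 ≤ f x) : 0 ≤ expectation p f :=
  Finset.sum_nonneg fun x _ => mul_nonneg ENNReal.toReal_nonneg (h x)

theorem expectation_bind (p : PMF X) (q : X → PMF Y) (f : Y → ℝ) :
    expectation (p.bind q) f = expectation p fun x => expectation (q x) f := by
  have h : ∀ y, (p.bind q y).toReal = ∑ x, (p x).toReal * (q x y).toReal := fun y => by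
    rw [PMF.bind_apply, tsum_fintype, ENNReal.toReal_sum fun x _ =>
      ENNReal.mul_ne_top (p.apply_ne_top x) ((q x).apply_ne_top y)]
    simp only [ENNReal.toReal_mul]
  simp only [expectation, h, Finset.sum_mul, Finset.mul_sum]
  rw [Finset.sum_comm]
  exact Finset.sum_congr rfl fun x _ => Finset.sum_congr rfl fun y _ => by ring

theorem expectation_pure (x : X) (f : X → ℝ) : expectation (PMF.pure x) f = f x := by
  rw [expectation, Finset.sum_eq_single x] <;> simp +contextual [PMF.pure_apply]

theorem expectation_map (p : PMF X) (g : X → Y) (f : Y → ℝ) :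
    expectation (p.map g) f = expectation p fun x => f (g x) := by
  rw [← PMF.bind_pure_comp, expectation_bind]
  simp only [Function.comp, expectation_pure]

theorem expectation_uniformOfFinset (s : Finset X) (hs : s.Nonempty) (f : X → ℝ) :
    expectation (PMF.uniformOfFinset s hs) f = (s.card : ℝ)⁻¹ * ∑ x ∈ s, f x := by
  simp only [expectation, PMF.uniformOfFinset_apply, Finset.mul_sum]
  rw [← Finset.sum_subset (Finset.subset_univ s)]
  · exact Finset.sum_congr rfl fun x hx => by simp [hx]
  · intro x _ hx
    simp [hx]

end Expectation

/-- The conditional expectation, given the past rounds, of a function of the click indicators of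
the next round. -/
def roundMean {L t : ℕ} (user : User L) (π : Policy L) (h : History L t) (g : Clicks L → ℝ) : ℝ :=
  expectation (π t h) fun a => expectation (user t h a) g

section RoundMean

variable {L t : ℕ} (user : User L) (π : Policy L) (h : History L t)

theorem roundMean_const (r : ℝ) : roundMean user π h (fun _ => r) = r := by
  simp only [roundMean, expectation_const]

theorem roundMean_add (f g : Clicks L → ℝ) :
    roundMean user π h (fun x => f x + g x) = roundMean user π h f + roundMean user π h g := by
  simp only [roundMean, expectation_add]

theorem roundMean_sub (f g : Clicks L → ℝ) :
    roundMean user π h (fun x => f x - g x) = roundMean user π h f - roundMean user π h g := by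
  simp only [roundMean, expectation_sub]

theorem roundMean_const_mul (r : ℝ) (f : Clicks L → ℝ) :
    roundMean user π h (fun x => r * f x) = r * roundMean user π h f := by
  simp only [roundMean, expectation_const_mul]

theorem roundMean_sum {ι : Type*} (s : Finset ι) (f : ι → Clicks L → ℝ) :
    roundMean user π h (fun x => ∑ i ∈ s, f i x) = ∑ i ∈ s, roundMean user π h (f i) := by
  simp only [roundMean, expectation_sum]

theorem roundMean_mono {f g : Clicks L → ℝ} (hfg : ∀ x, f x ≤ g x) :
    roundMean user π h f ≤ roundMean user π h g :=
  expectation_mono _ fun _ => expectation_mono _ hfg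

theorem roundMean_nonneg {f : Clicks L → ℝ} (hf : ∀ x, 0 ≤ f x) : 0 ≤ roundMean user π h f :=
  expectation_nonneg _ fun _ => expectation_nonneg _ hf

end RoundMean

/-- The tower property for a function of the first `t` rounds and of the clicks of the next. -/
theorem expectation_law_succ {L : ℕ} (user : User L) (π : Policy L) (t : ℕ)
    {f : History L (t + 1) → ℝ} {g : History L t → Clicks L → ℝ}
    (hfg : ∀ h a x, f (Fin.snoc (α := fun _ => Round L) h (a, x)) = g h x) :
    expectation (law user π (t + 1)) f
      = expectation (law user π t) fun h => roundMean user π h (g h) := by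
  simp only [law, expectation_bind, expectation_map, roundMean, hfg]

theorem expectation_law_zero {L : ℕ} (user : User L) (π : Policy L) (f : History L 0 → ℝ) :
    expectation (law user π 0) f = f Fin.elim0 := by
  rw [law, expectation_pure]

theorem click_nonneg (b : Bool) : 0 ≤ click b := by cases b <;> simp [click]

theorem click_le_one (b : Bool) : click b ≤ 1 := by cases b <;> simp [click]

/-- The probability of a click is the expectation of the click indicator. -/
theorem expectation_click {L : ℕ} {user : User L} {v : Action L → Fin L → ℝ}
    (hu : user.HasClickFunction v) (t : ℕ) (h : History L t) (a : Action L) (i : Fin L) :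
    expectation (user t h a) (fun x => (click (x i) : ℝ)) = v a (a.symm i) := by
  rw [← hu t h a i, ← expectation_map _ (fun c : Clicks L => c i) fun b => (click b : ℝ)]
  simp [expectation, click]

/-! ### The self-normalised deviation bound -/

/-- Hoeffding's lemma for a random sign with mean `m`. -/
theorem two_point_hoeffding {m : ℝ} (h0 : -1 ≤ m) (h1 : m ≤ 1) (l : ℝ) :
    (1 + m) / 2 * Real.exp (-l + l * m) + (1 - m) / 2 * Real.exp (l + l * m)
      ≤ Real.exp (l ^ 2 / 2) := by
  set p : unitInterval := ⟨(1 + m) / 2, by constructor <;> linarith⟩ with hp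
  have hpr : (p : ℝ) = (1 + m) / 2 := rfl
  set P := ProbabilityTheory.bernoulliMeasure (1 - m) (-1 - m) p with hP
  have key := (ProbabilityTheory.hasSubgaussianMGF_of_mem_Icc_of_integral_eq_zero
    (μ := P) (X := id) (a := -1 - m) (b := 1 - m) aemeasurable_id
    (by
      rw [hP, ProbabilityTheory.bernoulliMeasure_def, MeasureTheory.ae_add_measure_iff]
      refine ⟨MeasureTheory.Measure.ae_smul_measure ?_ _,
        MeasureTheory.Measure.ae_smul_measure ?_ _⟩
      · rw [MeasureTheory.ae_dirac_eq]
        exact ⟨by simp, le_rfl⟩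
      · rw [MeasureTheory.ae_dirac_eq]
        exact ⟨le_rfl, by simp⟩)
    (by
      rw [hP, ProbabilityTheory.integral_bernoulliMeasure]
      simp [hpr]
      ring)).mgf_le (-l)
  rw [ProbabilityTheory.mgf, hP, ProbabilityTheory.integral_bernoulliMeasure] at key
  have e : ((((‖(1 - m) - (-1 - m)‖₊ / 2) ^ 2 : NNReal) : ℝ)) = 1 := by
    rw [show (1 - m) - (-1 - m) = 2 by ring]
    simp
  rw [e] at key
  simp only [id, smul_eq_mul, hpr] at key
  refine (le_of_eq ?_).trans (key.trans (le_of_eq ?_)) <;> ring_nf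

/-- The mixture over `l`, uniform on `[0, 2]`, of the exponentials `exp (l D - l² N / 2)`. -/
def mixture (D N : ℝ) : ℝ := 1 / 2 * ∫ l in (0 : ℝ)..2, Real.exp (l * D - l ^ 2 * N / 2)

theorem mixture_zero : mixture 0 0 = 1 := by simp [mixture]

theorem mixture_nonneg (D N : ℝ) : 0 ≤ mixture D N :=
  mul_nonneg (by norm_num) (intervalIntegral.integral_nonneg (by norm_num)
    fun _ _ => (Real.exp_pos _).le)

/-- The mixture is a supermartingale if each of the exponentials is. -/
theorem roundMean_mixture_le {L t : ℕ} (user : User L) (π : Policy L) (h : History L t)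
    {D N : ℝ} {d u : Clicks L → ℝ}
    (hexp : ∀ l : ℝ, 0 ≤ l →
      roundMean user π h (fun x => Real.exp (l * d x - l ^ 2 * u x / 2)) ≤ 1) :
    roundMean user π h (fun x => mixture (D + d x) (N + u x)) ≤ mixture D N := by
  have hcont : ∀ x, Continuous fun l : ℝ =>
      Real.exp (l * (D + d x) - l ^ 2 * (N + u x) / 2) := fun x => by fun_prop
  have hcont' : Continuous fun l : ℝ => roundMean user π h fun x =>
      Real.exp (l * (D + d x) - l ^ 2 * (N + u x) / 2) := by
    simp only [roundMean, expectation]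
    fun_prop
  have hswap : roundMean user π h (fun x => mixture (D + d x) (N + u x))
      = 1 / 2 * ∫ l in (0 : ℝ)..2, roundMean user π h fun x =>
          Real.exp (l * (D + d x) - l ^ 2 * (N + u x) / 2) := by
    simp only [mixture, roundMean_const_mul]
    congr 1
    simp only [roundMean, expectation]
    rw [intervalIntegral.integral_finsetSum fun a _ =>
      Continuous.intervalIntegrable (by fun_prop) _ _]
    refine Finset.sum_congr rfl fun a _ => ?_
    rw [intervalIntegral.integral_const_mul, intervalIntegral.integral_finsetSum fun x _ =>
      Continuous.intervalIntegrable (by fun_prop) _ _]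
    congr 1
    exact Finset.sum_congr rfl fun x _ => (intervalIntegral.integral_const_mul _ _).symm
  rw [hswap, mixture]
  refine mul_le_mul_of_nonneg_left ?_ (by norm_num)
  refine intervalIntegral.integral_mono_on (by norm_num) (hcont'.intervalIntegrable _ _)
    (Continuous.intervalIntegrable (by fun_prop) _ _) fun l hl => ?_
  have hfac : ∀ x, Real.exp (l * (D + d x) - l ^ 2 * (N + u x) / 2)
      = Real.exp (l * D - l ^ 2 * N / 2) * Real.exp (l * d x - l ^ 2 * u x / 2) := fun x => by
    rw [← Real.exp_add]
    congr 1
    ring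
  simp only [hfac, roundMean_const_mul]
  exact mul_le_of_le_one_right (Real.exp_pos _).le (hexp l hl.1)

theorem erf_sqrt_two_pos : 0 < erf (√2) := by
  have h2 : (0 : ℝ) < √2 := by positivity
  refine mul_pos (by positivity) (intervalIntegral.intervalIntegral_pos_of_pos
    (Continuous.intervalIntegrable (by fun_prop) _ _) (fun x => Real.exp_pos _) h2)

theorem two_le_c : 2 ≤ c := by
  have hpi : 0 < √Real.pi := Real.sqrt_pos.2 Real.pi_pos
  have h2 : (0 : ℝ) ≤ √2 := by positivity
  have hint : ∫ u in (0 : ℝ)..√2, Real.exp (-u ^ 2) ≤ √2 := by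
    calc _ ≤ ∫ _ in (0 : ℝ)..√2, (1 : ℝ) :=
          intervalIntegral.integral_mono_on h2 (Continuous.intervalIntegrable (by fun_prop) _ _)
            (Continuous.intervalIntegrable (by fun_prop) _ _)
            fun u _ => Real.exp_le_one_iff.2 (by nlinarith [sq_nonneg u])
      _ = √2 := by simp
  rw [c, le_div_iff₀ erf_sqrt_two_pos, erf, Real.sqrt_div (by norm_num)]
  calc 2 * (2 / √Real.pi * ∫ u in (0 : ℝ)..√2, Real.exp (-u ^ 2))
      ≤ 2 * (2 / √Real.pi * √2) := by gcongr
    _ = 4 * (√2 / √Real.pi) := by ring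

theorem integral_gaussian_le_integral_shift {N x : ℝ} (hN : 0 ≤ N) (hx0 : 0 ≤ x) (hx2 : x ≤ 2) :
    ∫ u in (0 : ℝ)..2, Real.exp (-N * u ^ 2 / 2)
      ≤ ∫ u in (0 : ℝ)..2, Real.exp (-N * (u - x) ^ 2 / 2) := by
  set g : ℝ → ℝ := fun u => Real.exp (-N * u ^ 2 / 2) with hg
  have hgc : Continuous g := by fun_prop
  have hi : ∀ a b, IntervalIntegrable g MeasureTheory.volume a b :=
    fun a b => hgc.intervalIntegrable a b
  have h1 : ∫ u in (0 : ℝ)..2, g (u - x)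
      = (∫ u in (0 : ℝ)..x, g u) + ∫ u in (0 : ℝ)..(2 - x), g u := by
    rw [intervalIntegral.integral_comp_sub_right, ← intervalIntegral.integral_add_adjacent_intervals
      (hi (0 - x) 0) (hi 0 (2 - x))]
    congr 1
    have := intervalIntegral.integral_comp_neg (a := 0) (b := x) g
    simp only [neg_zero] at this
    rw [zero_sub, ← this]
    simp [hg]
  have h2 : ∫ u in (0 : ℝ)..2, g u
      = (∫ u in (0 : ℝ)..x, g (u + (2 - x))) + ∫ u in (0 : ℝ)..(2 - x), g u := by
    rw [intervalIntegral.integral_comp_add_right, ← intervalIntegral.integral_add_adjacent_intervals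
      (hi 0 (2 - x)) (hi (2 - x) 2), add_comm]
    congr 2 <;> ring
  change ∫ u in (0 : ℝ)..2, g u ≤ ∫ u in (0 : ℝ)..2, g (u - x)
  rw [h1, h2]
  gcongr
  refine intervalIntegral.integral_mono_on hx0 (Continuous.intervalIntegrable (by fun_prop) _ _)
    (hi _ _) fun u hu => ?_
  simp only [hg, Real.exp_le_exp]
  have : u ^ 2 ≤ (u + (2 - x)) ^ 2 := pow_le_pow_left₀ hu.1 (by linarith) 2
  nlinarith

/-- The constant `c` is what Laplace's method gives for the mixture. -/
theorem two_mul_exp_le_mixture {D N : ℝ} (hN : 1 ≤ N) (hD0 : 0 ≤ D) (hD2 : D ≤ 2 * N) :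
    2 * Real.exp (D ^ 2 / (2 * N)) ≤ c * √N * mixture D N := by
  have hN0 : 0 < N := by linarith
  have hsq : ∀ l : ℝ, Real.exp (l * D - l ^ 2 * N / 2)
      = Real.exp (D ^ 2 / (2 * N)) * Real.exp (-N * (l - D / N) ^ 2 / 2) := fun l => by
    rw [← Real.exp_add]
    congr 1
    field_simp
    ring
  have hshift := integral_gaussian_le_integral_shift hN0.le (div_nonneg hD0 hN0.le)
    ((div_le_iff₀ hN0).2 hD2)
  set r : ℝ := √(N / 2) with hr
  have hr0 : 0 < r := Real.sqrt_pos.2 (by positivity)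
  have hr2 : r ^ 2 = N / 2 := Real.sq_sqrt (by positivity)
  have hscale : ∫ u in (0 : ℝ)..2, Real.exp (-N * u ^ 2 / 2)
      = r⁻¹ * ∫ u in (0 : ℝ)..(r * 2), Real.exp (-u ^ 2) := by
    have := intervalIntegral.integral_comp_mul_left (a := 0) (b := 2)
      (fun u => Real.exp (-u ^ 2)) hr0.ne'
    simp only [mul_zero, smul_eq_mul] at this
    rw [← this]
    congr 1
    ext u
    rw [mul_pow, hr2]
    congr 1
    ring
  have hsub : ∫ u in (0 : ℝ)..√2, Real.exp (-u ^ 2)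
      ≤ ∫ u in (0 : ℝ)..(r * 2), Real.exp (-u ^ 2) := by
    have hle : √2 ≤ r * 2 := by
      refine Real.sqrt_le_iff.2 ⟨by positivity, ?_⟩
      rw [mul_pow, hr2]
      linarith
    refine intervalIntegral.integral_mono_interval le_rfl (by positivity) hle
      (Filter.Eventually.of_forall fun u => (Real.exp_pos _).le)
      (Continuous.intervalIntegrable (by fun_prop) _ _)
  set J := ∫ u in (0 : ℝ)..√2, Real.exp (-u ^ 2) with hJ
  have hc0 : 0 < c := by linarith [two_le_c]
  have hcJ : c * √N * (1 / 2 * (r⁻¹ * J)) = 2 := by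
    have hpi : 0 < √Real.pi := Real.sqrt_pos.2 Real.pi_pos
    have hJ0 : J ≠ 0 := by
      intro h0
      have := erf_sqrt_two_pos
      rw [erf, ← hJ, h0] at this
      simp at this
    have hNr : √N = √2 * r := by
      rw [hr, ← Real.sqrt_mul (by norm_num)]
      congr 1
      ring
    have h22 : √2 * √2 = 2 := Real.mul_self_sqrt (by norm_num)
    rw [c, erf, ← hJ, hNr, Real.sqrt_div (by norm_num)]
    field_simp
    nlinarith [h22]
  calc 2 * Real.exp (D ^ 2 / (2 * N))
      = c * √N * (1 / 2 * (Real.exp (D ^ 2 / (2 * N)) * (r⁻¹ * J))) := by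
        nth_rewrite 1 [← hcJ]
        ring
    _ ≤ c * √N * mixture D N := by
        rw [mixture]
        simp only [hsq, intervalIntegral.integral_const_mul]
        gcongr
        refine le_trans ?_ hshift
        rw [hscale]
        gcongr

/-- A deviation of the size that the algorithm tests for makes the mixture large. -/
theorem two_div_le_mixture {D N δ : ℝ} (hδ : 0 < δ) (hN : 1 ≤ N) (hD2 : D ≤ 2 * N)
    (hD : √(2 * N * Real.log (c / δ * √N)) ≤ D) : 2 / δ ≤ mixture D N := by
  have hN0 : 0 < N := by linarith
  have hc0 : 0 < c := by linarith [two_le_c]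
  have hD0 : 0 ≤ D := (Real.sqrt_nonneg _).trans hD
  have hlog : Real.log (c / δ * √N) ≤ D ^ 2 / (2 * N) := by
    rw [le_div_iff₀ (by positivity), mul_comm]
    exact (Real.sqrt_le_left hD0).1 hD
  have h1 : c / δ * √N ≤ Real.exp (D ^ 2 / (2 * N)) := by
    rw [← Real.exp_log (show 0 < c / δ * √N by positivity)]
    exact Real.exp_le_exp.2 hlog
  have h2 := two_mul_exp_le_mixture hN hD0 hD2
  have h3 : c * √N * (2 / δ) ≤ c * √N * mixture D N := by
    calc c * √N * (2 / δ) = 2 * (c / δ * √N) := by ring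
      _ ≤ _ := by linarith
  exact le_of_mul_le_mul_left h3 (by positivity)

/-! ### Blocks of a sound relation -/

variable {L : ℕ}

/-- A relation is sound if every arrow leads from an item to a better one; when the
attractiveness is decreasing, better items are those with a smaller index. -/
def Sound (G : Set (Fin L × Fin L)) : Prop := ∀ p ∈ G, p.2 < p.1

theorem Sound.acyclic {G : Set (Fin L × Fin L)} (hG : Sound G) : Acyclic G := by
  intro i hi
  have key : ∀ j, Relation.TransGen (fun x y => (x, y) ∈ G) i j → j < i := by
    intro j hj
    induction hj with
    | single h => exact hG _ h
    | tail _ h ih => exact (hG _ h).trans ih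
  exact lt_irrefl i (key i hi)

theorem not_sameBlock {G : Set (Fin L × Fin L)} {i j : Fin L} (h : (j, i) ∈ G) :
    ¬ SameBlock G i j := by
  rintro ⟨d, hi, hj⟩
  simp only [block, minElements, Finset.mem_filter] at hi hj
  exact hj.2 i hi.1 h

theorem SameBlock.symm {G : Set (Fin L × Fin L)} {i j : Fin L} (h : SameBlock G i j) :
    SameBlock G j i := by
  obtain ⟨d, hi, hj⟩ := h
  exact ⟨d, hj, hi⟩

theorem sameBlock_comm {G : Set (Fin L × Fin L)} {i j : Fin L} :
    SameBlock G i j ↔ SameBlock G j i := ⟨SameBlock.symm, SameBlock.symm⟩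

/-- Exchanging two items of a block is a symmetry of the set of admissible actions. -/
theorem swap_mul_mem_blockActions {G : Set (Fin L × Fin L)} {i j : Fin L} (h : SameBlock G i j)
    {a : Action L} (ha : a ∈ blockActions G) : Equiv.swap i j * a ∈ blockActions G := by
  have hswap : ∀ d x, x ∈ block G d → Equiv.swap i j x ∈ block G d := by
    intro d x hx
    obtain ⟨e, hi, hj⟩ := h
    rcases eq_or_ne x i with rfl | hxi
    · rw [Equiv.swap_apply_left, eq_of_mem_block hx hi]
      exact hj
    rcases eq_or_ne x j with rfl | hxj
    · rw [Equiv.swap_apply_right, eq_of_mem_block hx hj]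
      exact hi
    · rwa [Equiv.swap_apply_of_ne_of_ne hxi hxj]
  simp only [blockActions, Finset.mem_filter, Finset.mem_univ, true_and] at ha ⊢
  intro d x hx y hy
  exact ha d _ (hswap d x hx) _ (hswap (d + 1) y hy)

theorem sum_blockActions_swap {G : Set (Fin L × Fin L)} {i j : Fin L} (h : SameBlock G i j)
    (f : Action L → ℝ) :
    ∑ a ∈ blockActions G, f (Equiv.swap i j * a) = ∑ a ∈ blockActions G, f a := by
  refine Finset.sum_nbij' (fun a => Equiv.swap i j * a) (fun a => Equiv.swap i j * a)
    (fun a => swap_mul_mem_blockActions h) (fun a => swap_mul_mem_blockActions h) ?_ ?_ ?_ <;>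
  simp

theorem symm_le_of_block_lt {G : Set (Fin L × Fin L)} (hG : Acyclic G) {a : Action L}
    (ha : a ∈ blockActions G) {i : Fin L} {d : ℕ} (hi : i ∈ block G d) :
    ∀ {e : ℕ}, d < e → ∀ {j : Fin L}, j ∈ block G e → a.symm i ≤ a.symm j := by
  simp only [blockActions, Finset.mem_filter, Finset.mem_univ, true_and] at ha
  intro e hde
  induction e, hde using Nat.le_induction with
  | base => exact fun hj => ha d i hi _ hj
  | succ e hde ih =>
    intro j hj
    -- a block before a non-empty block is non-empty
    obtain ⟨x, hx⟩ := minElements_nonempty hG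
      ⟨j, remaining_anti G e.le_succ (Finset.filter_subset _ _ hj)⟩
    exact (ih hx).trans (ha e x hx j hj)

theorem mem_remaining_iff {G : Set (Fin L × Fin L)} {i : Fin L} {e : ℕ} (hi : i ∈ block G e)
    (d : ℕ) : i ∈ remaining G d ↔ d ≤ e := by
  constructor
  · intro h
    by_contra! hlt
    have := remaining_anti G hlt h
    simp only [remaining, Finset.mem_sdiff] at this
    exact this.2 hi
  · intro h
    exact remaining_anti G h (Finset.filter_subset _ _ hi)

/-- The best item of a block of a sound relation is at least as good as the position of any item
of the block, under every admissible action: it is the best item of all those that remain when the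
block is formed. -/
theorem exists_leader {G : Set (Fin L × Fin L)} (hG : Sound G) (j : Fin L) :
    ∃ i, i ≤ j ∧ SameBlock G i j ∧ ∀ a ∈ blockActions G, i ≤ a.symm j := by
  obtain ⟨d, hj⟩ := exists_mem_block hG.acyclic j
  have hjr : j ∈ remaining G d := Finset.filter_subset _ _ hj
  set m := (remaining G d).min' ⟨j, hjr⟩ with hm
  have hmle : ∀ x ∈ remaining G d, m ≤ x := fun x hx => Finset.min'_le _ x hx
  have hmb : m ∈ block G d := by
    simp only [block, minElements, Finset.mem_filter]
    exact ⟨Finset.min'_mem _ _, fun x hx hmx => absurd (hG _ hmx) (not_lt.2 (hmle x hx))⟩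
  refine ⟨m, hmle j hjr, ⟨d, hmb, hj⟩, fun a ha => ?_⟩
  -- one of the first `a.symm j + 1` items is placed at position `a.symm j` or later
  obtain ⟨i, hij, hi⟩ : ∃ i, i ≤ a.symm j ∧ a.symm j ≤ a.symm i := by
    by_contra! hall
    have hsub : (Finset.Iic (a.symm j)).image a.symm ⊆ Finset.Iio (a.symm j) := by
      intro k hk
      obtain ⟨i, hi, rfl⟩ := Finset.mem_image.1 hk
      exact Finset.mem_Iio.2 (hall i (Finset.mem_Iic.1 hi))
    have := Finset.card_le_card hsub
    rw [Finset.card_image_of_injective _ a.symm.injective, Fin.card_Iic, Fin.card_Iio] at this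
    omega
  obtain ⟨e, he⟩ := exists_mem_block hG.acyclic i
  refine (hmle i ((mem_remaining_iff he d).2 ?_)).trans hij
  by_contra! hlt
  have heq := le_antisymm hi (symm_le_of_block_lt hG.acyclic ha he hlt hj)
  obtain rfl := a.symm.injective heq
  exact hlt.ne (eq_of_mem_block he hj)

/-! ### One round with a sound relation -/

/-- The probability that item `i` is clicked in a round with relation `G`. -/
def meanClick (v : Action L → Fin L → ℝ) (G : Set (Fin L × Fin L)) (i : Fin L) : ℝ :=
  ((blockActions G).card : ℝ)⁻¹ * ∑ a ∈ blockActions G, v a (a.symm i)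

/-- The value of an action, as a sum over the items. -/
theorem sum_symm_eq_value {K : ℕ} {α : Fin L → ℝ} {v : Action L → Fin L → ℝ}
    (hA : Assumptions K α v) (a b : Action L) : ∑ i, v a (b.symm i) = value K v a := by
  rw [Equiv.sum_comp b.symm (v a), value, Finset.sum_filter]
  refine Finset.sum_congr rfl fun k _ => ?_
  split_ifs with hk
  · rfl
  · exact hA.zero a k (not_lt.1 hk)

theorem card_filter_val_lt_le (K : ℕ) :
    (Finset.univ.filter fun k : Fin L => k.val < K).card ≤ K := by
  calc _ = ((Finset.univ.filter fun k : Fin L => k.val < K).image Fin.val).card :=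
        (Finset.card_image_of_injective _ Fin.val_injective).symm
    _ ≤ (Finset.range K).card := Finset.card_le_card fun x hx => by
        obtain ⟨k, hk, rfl⟩ := Finset.mem_image.1 hx
        simpa using hk
    _ = K := Finset.card_range K

theorem value_le {K : ℕ} {α : Fin L → ℝ} {v : Action L → Fin L → ℝ}
    (hA : Assumptions K α v) (a : Action L) : value K v a ≤ K := by
  calc value K v a ≤ ∑ k : Fin L with k.val < K, (1 : ℝ) :=
        Finset.sum_le_sum fun k _ => (hA.click_mem a k).2
    _ ≤ K := by
        rw [Finset.sum_const, nsmul_eq_mul, mul_one]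
        exact_mod_cast card_filter_val_lt_le K

theorem maxValue_eq {K : ℕ} {α : Fin L → ℝ} {v : Action L → Fin L → ℝ}
    (hA : Assumptions K α v) (hα : StrictAnti α) : maxValue K v = value K v 1 :=
  hA.optimal 1 fun _ _ _ hk => hα.antitone hk

/-- If an item is placed at position `k` that belongs at `k` or higher up, then position `k` is
clicked at least as often as under the ranking by attractiveness. -/
theorem click_one_le {K : ℕ} {α : Fin L → ℝ} {v : Action L → Fin L → ℝ}
    (hA : Assumptions K α v) (hα : StrictAnti α) (a : Action L) {k : Fin L} (hk : a k ≤ k) :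
    v 1 k ≤ v a k := by
  have hopt : IsOptimal K α (1 : Action L) := fun _ _ _ hk => hα.antitone hk
  rcases hk.eq_or_lt with heq | hlt
  · exact hA.lowest a 1 hopt k (by rw [heq]; rfl)
  have hlow : v 1 k ≤ v (Equiv.swap (a k) k * a) k :=
    hA.lowest _ 1 hopt k (by simp)
  have hex := hA.exchange (a k) k (hα.antitone hk) a
  rw [Equiv.symm_apply_apply] at hex
  have hlt' := hα hlt
  have h0 : 0 ≤ α k := (hA.attractiveness_mem k).1
  have hv0 : 0 ≤ v a k := (hA.click_mem a k).1
  have hv1 : 0 ≤ v 1 k := (hA.click_mem 1 k).1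
  have h1 : α (a k) * v 1 k ≤ α k * v a k :=
    (mul_le_mul_of_nonneg_left hlow (h0.trans hlt'.le)).trans hex
  -- arguing by contradiction avoids a division by `α k`, which may vanish
  by_contra! hcon
  have hle : α k * v a k ≤ α k * v 1 k := mul_le_mul_of_nonneg_left hcon.le h0
  have : α k * v 1 k < α (a k) * v 1 k := mul_lt_mul_of_pos_right hlt' (hv0.trans_lt hcon)
  linarith

section OneRound

variable {K : ℕ} {α : Fin L → ℝ} {v : Action L → Fin L → ℝ} {G : Set (Fin L × Fin L)}

theorem meanClick_nonneg (hA : Assumptions K α v) (i : Fin L) : 0 ≤ meanClick v G i :=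
  mul_nonneg (by positivity) (Finset.sum_nonneg fun a _ => (hA.click_mem _ _).1)

/-- By symmetry, item `i` is clicked as often as if it replaced item `j` of its block. -/
theorem meanClick_eq_swap {i j : Fin L} (h : SameBlock G i j) :
    meanClick v G i = ((blockActions G).card : ℝ)⁻¹ *
      ∑ a ∈ blockActions G, v (Equiv.swap i j * a) (a.symm j) := by
  rw [meanClick, ← sum_blockActions_swap h]
  congr 1
  refine Finset.sum_congr rfl fun a _ => ?_
  congr 1
  rw [Equiv.symm_apply_eq, Equiv.Perm.mul_apply, Equiv.apply_symm_apply, Equiv.swap_apply_right]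

theorem mul_meanClick_le (hA : Assumptions K α v) {i j : Fin L} (h : SameBlock G i j)
    (hij : α j ≤ α i) : α i * meanClick v G j ≤ α j * meanClick v G i := by
  rw [meanClick_eq_swap h.symm, meanClick, mul_left_comm, mul_left_comm (α j)]
  refine mul_le_mul_of_nonneg_left ?_ (by positivity)
  rw [Finset.mul_sum, Finset.mul_sum]
  refine Finset.sum_le_sum fun a _ => ?_
  rw [Equiv.swap_comm]
  exact hA.exchange i j hij a

theorem blockActions_card_pos (hG : Acyclic G) : 0 < ((blockActions G).card : ℝ) := by
  exact_mod_cast Finset.card_pos.2 (blockActions_nonempty hG)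

theorem average_le (hG : Acyclic G) {f : Action L → ℝ} {r : ℝ} (h : ∀ a ∈ blockActions G, f a ≤ r) :
    ((blockActions G).card : ℝ)⁻¹ * ∑ a ∈ blockActions G, f a ≤ r := by
  rw [inv_mul_le_iff₀ (blockActions_card_pos hG), ← nsmul_eq_mul]
  exact Finset.sum_le_card_nsmul _ _ _ h

theorem le_average (hG : Acyclic G) {f : Action L → ℝ} {r : ℝ} (h : ∀ a ∈ blockActions G, r ≤ f a) :
    r ≤ ((blockActions G).card : ℝ)⁻¹ * ∑ a ∈ blockActions G, f a := by
  rw [le_inv_mul_iff₀ (blockActions_card_pos hG), ← nsmul_eq_mul]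
  exact Finset.card_nsmul_le_sum _ _ _ h

theorem sum_meanClick_le (hA : Assumptions K α v) (hG : Acyclic G) :
    ∑ i, meanClick v G i ≤ K := by
  simp only [meanClick]
  rw [← Finset.mul_sum, Finset.sum_comm]
  refine average_le hG fun a _ => ?_
  rw [sum_symm_eq_value hA]
  exact value_le hA a

theorem sum_block_meanClick_le (hA : Assumptions K α v) (hG : Acyclic G) (i : Fin L) :
    ∑ j with SameBlock G i j, meanClick v G i ≤ K := by
  rw [Finset.sum_congr rfl fun j hj => meanClick_eq_swap (Finset.mem_filter.1 hj).2,
    ← Finset.mul_sum, Finset.sum_comm]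
  refine average_le hG fun a _ => ?_
  calc ∑ j with SameBlock G i j, v (Equiv.swap i j * a) (a.symm j)
      ≤ ∑ j with SameBlock G i j, if (a.symm j).val < K then (1 : ℝ) else 0 := by
        refine Finset.sum_le_sum fun j _ => ?_
        split_ifs with hk
        · exact (hA.click_mem _ _).2
        · exact (hA.zero _ _ (not_lt.1 hk)).le
    _ ≤ ∑ j, if (a.symm j).val < K then (1 : ℝ) else 0 :=
        Finset.sum_le_sum_of_subset_of_nonneg (Finset.filter_subset _ _) fun j _ _ => by
          split_ifs <;> norm_num
    _ = ∑ k : Fin L, if k.val < K then (1 : ℝ) else 0 :=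
        Equiv.sum_comp a.symm fun k : Fin L => if k.val < K then (1 : ℝ) else 0
    _ ≤ K := by
        rw [← Finset.sum_filter, Finset.sum_const, nsmul_eq_mul, mul_one]
        exact_mod_cast card_filter_val_lt_le K

/-- The expected regret of a round is at most the sum of the expected differences of clicks over
the pairs of items in a common block. -/
theorem value_sub_sum_meanClick_le (hA : Assumptions K α v) (hα : StrictAnti α) (hG : Sound G) :
    value K v 1 - ∑ j, meanClick v G j
      ≤ ∑ j, ∑ i with i < j ∧ i.val < K,
          if SameBlock G i j then meanClick v G i - meanClick v G j else 0 := by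
  have hterm : ∀ i j : Fin L, i ≤ j →
      0 ≤ if SameBlock G i j then meanClick v G i - meanClick v G j else 0 := by
    intro i j hij
    split_ifs with hs
    · have h1 := mul_meanClick_le hA hs (hα.antitone hij)
      have hi := meanClick_nonneg (G := G) hA i
      have hj := meanClick_nonneg (G := G) hA j
      rcases hij.eq_or_lt with rfl | hlt
      · simp
      have h2 := hα hlt
      have h3 := (hA.attractiveness_mem j).1
      by_contra! hneg
      have : α j * meanClick v G i ≤ α j * meanClick v G j :=
        mul_le_mul_of_nonneg_left (by linarith) h3
      have : α j * meanClick v G j < α i * meanClick v G j :=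
        mul_lt_mul_of_pos_right h2 (by linarith)
      linarith
    · exact le_rfl
  choose I hI using fun j => exists_leader hG j
  have hcard := blockActions_card_pos hG.acyclic
  have hvalue : value K v 1 ≤ ∑ j, if (I j).val < K then meanClick v G (I j) else 0 := by
    have hrew : ∀ j, (if (I j).val < K then meanClick v G (I j) else 0)
        = ((blockActions G).card : ℝ)⁻¹ * ∑ a ∈ blockActions G,
          if (I j).val < K then v (Equiv.swap (I j) j * a) (a.symm j) else 0 := by
      intro j
      split_ifs
      · exact meanClick_eq_swap (hI j).2.1
      · simp
    simp only [hrew]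
    rw [← Finset.mul_sum, Finset.sum_comm]
    refine le_average hG.acyclic fun a ha => ?_
    rw [← sum_symm_eq_value hA 1 a]
    refine Finset.sum_le_sum fun j _ => ?_
    have hle := (hI j).2.2 a ha
    split_ifs with hK
    · refine click_one_le hA hα _ ?_
      simpa using hle
    · exact (hA.zero _ _ (le_trans (not_lt.1 hK) (Fin.le_def.1 hle))).le
  calc value K v 1 - ∑ j, meanClick v G j
      ≤ ∑ j, if (I j).val < K then meanClick v G (I j) - meanClick v G j else 0 := by
        rw [sub_le_iff_le_add, ← Finset.sum_add_distrib]
        refine hvalue.trans (Finset.sum_le_sum fun j _ => ?_)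
        split_ifs
        · simp
        · simpa using meanClick_nonneg hA j
    _ ≤ _ := by
        refine Finset.sum_le_sum fun j _ => ?_
        have hnn : ∀ i ∈ Finset.univ.filter (fun i : Fin L => i < j ∧ i.val < K),
            0 ≤ if SameBlock G i j then meanClick v G i - meanClick v G j else 0 :=
          fun i hi => hterm i j (Finset.mem_filter.1 hi).2.1.le
        split_ifs with hK
        · rcases (hI j).1.eq_or_lt with heq | hlt
          · rw [heq, sub_self]
            exact Finset.sum_nonneg hnn
          · have := Finset.single_le_sum hnn
              (Finset.mem_filter.2 ⟨Finset.mem_univ (I j), hlt, hK⟩)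
            rwa [if_pos (hI j).2.1] at this
        · exact Finset.sum_nonneg hnn

end OneRound

section OneRoundOfTopRank

variable {L K t : ℕ} {α : Fin L → ℝ} {v : Action L → Fin L → ℝ} {user : User L} {δ : ℝ}
  (fallback : Policy L) {h : History L t}

theorem roundMean_click (hu : user.HasClickFunction v) (hG : Acyclic (state δ t h).G) (i : Fin L) :
    roundMean user (topRank δ fallback) h (fun x => (click (x i) : ℝ))
      = meanClick v (state δ t h).G i := by
  simp only [roundMean, expectation_click hu, topRank, dif_pos hG, expectation_uniformOfFinset,
    meanClick]

theorem roundMean_clickDiff (hu : user.HasClickFunction v) (hG : Acyclic (state δ t h).G)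
    (i j : Fin L) :
    roundMean user (topRank δ fallback) h (fun x => (clickDiff (state δ t h).G x i j : ℝ))
      = if SameBlock (state δ t h).G i j then
          meanClick v (state δ t h).G i - meanClick v (state δ t h).G j else 0 := by
  split_ifs with hs
  · simp only [clickDiff, if_pos hs, Int.cast_sub, roundMean_sub, roundMean_click fallback hu hG]
  · simp only [clickDiff, if_neg hs, Int.cast_zero, roundMean_const]

theorem roundMean_abs_clickDiff_le (hu : user.HasClickFunction v) (hG : Acyclic (state δ t h).G)
    (i j : Fin L) :
    roundMean user (topRank δ fallback) h (fun x => (|clickDiff (state δ t h).G x i j| : ℝ))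
      ≤ if SameBlock (state δ t h).G i j then
          meanClick v (state δ t h).G i + meanClick v (state δ t h).G j else 0 := by
  split_ifs with hs
  · rw [← roundMean_click fallback hu hG i, ← roundMean_click fallback hu hG j, ← roundMean_add]
    refine roundMean_mono _ _ _ fun x => ?_
    have hi : (0 : ℝ) ≤ click (x i) := by exact_mod_cast click_nonneg _
    have hj : (0 : ℝ) ≤ click (x j) := by exact_mod_cast click_nonneg _
    simp only [clickDiff, if_pos hs, Int.cast_sub]
    rw [abs_le]
    constructor <;> linarith
  · simp only [clickDiff, if_neg hs, Int.cast_zero, abs_zero, roundMean_const, le_refl]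

/-- The ratio `(α(i) - α(j)) / (α(i) + α(j))`, a lower bound on the conditional mean of `U_{tij}`
given that it does not vanish. -/
def relGap (α : Fin L → ℝ) (i j : Fin L) : ℝ := (α i - α j) / (α i + α j)

theorem Assumptions.sum_pos (hA : Assumptions K α v) (hα : StrictAnti α) {i j : Fin L}
    (hij : i < j) : 0 < α i + α j := by
  have h1 := (hA.attractiveness_mem j).1
  have h2 := hα hij
  linarith

theorem relGap_pos (hA : Assumptions K α v) (hα : StrictAnti α) {i j : Fin L} (hij : i < j) :
    0 < relGap α i j :=
  div_pos (sub_pos.2 (hα hij)) (hA.sum_pos hα hij)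

theorem relGap_le_one (hA : Assumptions K α v) (hα : StrictAnti α) {i j : Fin L} (hij : i < j) :
    relGap α i j ≤ 1 := by
  rw [relGap, div_le_one (hA.sum_pos hα hij)]
  linarith [(hA.attractiveness_mem j).1]

theorem relGap_mul_le (hA : Assumptions K α v) (hα : StrictAnti α) (hu : user.HasClickFunction v)
    (hG : Acyclic (state δ t h).G) {i j : Fin L} (hij : i < j) :
    relGap α i j *
        roundMean user (topRank δ fallback) h (fun x => (|clickDiff (state δ t h).G x i j| : ℝ))
      ≤ roundMean user (topRank δ fallback) h (fun x => (clickDiff (state δ t h).G x i j : ℝ)) := by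
  refine (mul_le_mul_of_nonneg_left (roundMean_abs_clickDiff_le fallback hu hG i j)
    (relGap_pos hA hα hij).le).trans ?_
  rw [roundMean_clickDiff fallback hu hG]
  split_ifs with hs
  · have := mul_meanClick_le (G := (state δ t h).G) hA hs (hα.antitone hij.le)
    rw [relGap, div_mul_eq_mul_div, div_le_iff₀ (hA.sum_pos hα hij)]
    nlinarith
  · simp

theorem clickDiff_trichotomy (G : Set (Fin L × Fin L)) (x : Clicks L) (i j : Fin L) :
    clickDiff G x i j = 0 ∨ clickDiff G x i j = 1 ∨ clickDiff G x i j = -1 := by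
  have h1 := click_nonneg (x i)
  have h2 := click_le_one (x i)
  have h3 := click_nonneg (x j)
  have h4 := click_le_one (x j)
  unfold clickDiff
  split_ifs <;> omega

/-- The exponential supermartingale inequality: on `{-1, 0, 1}` the exponential is an affine
function of `U` and `|U|`, so only the means of `U` and `|U|` matter. -/
theorem roundMean_exp_le_one (hA : Assumptions K α v) (hα : StrictAnti α)
    (hu : user.HasClickFunction v) (hG : Acyclic (state δ t h).G) {i j : Fin L} (hij : i < j)
    {l : ℝ} (hl : 0 ≤ l) :
    roundMean user (topRank δ fallback) h (fun x =>
      Real.exp (l * (relGap α i j * |(clickDiff (state δ t h).G x i j : ℝ)|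
          - clickDiff (state δ t h).G x i j)
        - l ^ 2 * |(clickDiff (state δ t h).G x i j : ℝ)| / 2)) ≤ 1 := by
  set m := relGap α i j
  have hm0 : 0 < m := relGap_pos hA hα hij
  have hm1 : m ≤ 1 := relGap_le_one hA hα hij
  set p := Real.exp (-l + l * m) * Real.exp (-(l ^ 2 / 2)) with hp
  set q := Real.exp (l + l * m) * Real.exp (-(l ^ 2 / 2)) with hq
  have haff : ∀ x, Real.exp (l * (m * |(clickDiff (state δ t h).G x i j : ℝ)|
          - clickDiff (state δ t h).G x i j)
        - l ^ 2 * |(clickDiff (state δ t h).G x i j : ℝ)| / 2)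
      = 1 + ((p + q) / 2 - 1) * |(clickDiff (state δ t h).G x i j : ℝ)|
        + (p - q) / 2 * (clickDiff (state δ t h).G x i j : ℝ) := by
    intro x
    rcases clickDiff_trichotomy (state δ t h).G x i j with h0 | h0 | h0 <;> rw [h0]
    · simp
    · simp only [Int.cast_one, abs_one, hp, hq, ← Real.exp_add]
      ring_nf
    · simp only [Int.cast_neg, Int.cast_one, abs_neg, abs_one, hp, hq, ← Real.exp_add]
      ring_nf
  simp only [haff, roundMean_add, roundMean_const, roundMean_const_mul]
  have hdrift := relGap_mul_le fallback hA hα hu hG hij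
  set EU := roundMean user (topRank δ fallback) h
    fun x => (clickDiff (state δ t h).G x i j : ℝ)
  have hEA : 0 ≤ roundMean user (topRank δ fallback) h
    fun x => |(clickDiff (state δ t h).G x i j : ℝ)| := roundMean_nonneg _ _ _ fun x => abs_nonneg _
  set EA := roundMean user (topRank δ fallback) h
    fun x => |(clickDiff (state δ t h).G x i j : ℝ)|
  have hpq : p ≤ q := by
    rw [hp, hq]
    gcongr
    linarith
  have hhoeff : (1 + m) / 2 * p + (1 - m) / 2 * q ≤ 1 := by
    calc _ = ((1 + m) / 2 * Real.exp (-l + l * m) + (1 - m) / 2 * Real.exp (l + l * m))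
          * Real.exp (-(l ^ 2 / 2)) := by rw [hp, hq]; ring
      _ ≤ Real.exp (l ^ 2 / 2) * Real.exp (-(l ^ 2 / 2)) := by
          gcongr
          exact two_point_hoeffding (by linarith) hm1 l
      _ = 1 := by rw [← Real.exp_add, add_neg_cancel, Real.exp_zero]
  have h1 : (p - q) / 2 * EU ≤ (p - q) / 2 * (m * EA) :=
    mul_le_mul_of_nonpos_left hdrift (by linarith)
  have h2 : (((p + q) / 2 - 1) + (p - q) / 2 * m) * EA ≤ 0 :=
    mul_nonpos_of_nonpos_of_nonneg (by linarith) hEA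
  linarith

end OneRoundOfTopRank

/-! ### The failure event -/

section Failure

variable {L K : ℕ} {α : Fin L → ℝ} {v : Action L → Fin L → ℝ} {user : User L} {δ : ℝ}

theorem state_succ {t : ℕ} (h : History L (t + 1)) :
    state δ (t + 1) h = (state δ t (Fin.init h)).update δ (h (Fin.last t)).2 := rfl

theorem clickDiff_swap (G : Set (Fin L × Fin L)) (x : Clicks L) (i j : Fin L) :
    clickDiff G x j i = -clickDiff G x i j := by
  simp only [clickDiff, sameBlock_comm (i := j)]
  split_ifs <;> ring

theorem state_S_swap {t : ℕ} (h : History L t) (i j : Fin L) :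
    (state δ t h).S j i = -(state δ t h).S i j := by
  induction t with
  | zero => simp [state]
  | succ t ih =>
    rw [state_succ]
    simp only [State.update, ih, clickDiff_swap _ _ i j]
    ring

theorem state_N_swap {t : ℕ} (h : History L t) (i j : Fin L) :
    (state δ t h).N j i = (state δ t h).N i j := by
  induction t with
  | zero => simp [state]
  | succ t ih =>
    rw [state_succ]
    simp only [State.update, ih, clickDiff_swap _ _ i j, abs_neg]

theorem abs_state_S_le {t : ℕ} (h : History L t) (i j : Fin L) :
    |(state δ t h).S i j| ≤ (state δ t h).N i j := by
  induction t with
  | zero => simp [state]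
  | succ t ih =>
    rw [state_succ]
    exact (abs_add_le _ _).trans (add_le_add_left (ih _) _)

theorem state_N_le {t : ℕ} (h : History L t) (i j : Fin L) : (state δ t h).N i j ≤ t := by
  induction t with
  | zero => simp [state]
  | succ t ih =>
    rw [state_succ]
    have h1 : |clickDiff (state δ t (Fin.init h)).G (h (Fin.last t)).2 i j| ≤ 1 := by
      rcases clickDiff_trichotomy (state δ t (Fin.init h)).G (h (Fin.last t)).2 i j
        with h0 | h0 | h0 <;> simp [h0]
    have h2 := ih (Fin.init h)
    simp only [State.update]
    push_cast
    linarith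

/-- The statistic `S_{ij}` has fallen short of its drift by the confidence width of the
algorithm. -/
def Deviates (α : Fin L → ℝ) (δ : ℝ) (s : State L) (i j : Fin L) : Prop :=
  0 < s.N i j ∧ √(2 * s.N i j * Real.log (c / δ * √(s.N i j))) ≤ relGap α i j * s.N i j - s.S i j

/-- No statistic has deviated so far. -/
def Good (α : Fin L → ℝ) (δ : ℝ) : ∀ t : ℕ, History L t → Prop
  | 0, _ => True
  | t + 1, h => Good α δ t (Fin.init h) ∧ ∀ i j, i < j → ¬ Deviates α δ (state δ (t + 1) h) i j

/-- The statistic of the pair `(i, j)` is among the first ones to deviate. -/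
def Failed (α : Fin L → ℝ) (δ : ℝ) (i j : Fin L) : ∀ t : ℕ, History L t → Prop
  | 0, _ => False
  | t + 1, h => Failed α δ i j t (Fin.init h) ∨
      (Good α δ t (Fin.init h) ∧ Deviates α δ (state δ (t + 1) h) i j)

theorem exists_failed_of_not_good {t : ℕ} {h : History L t} (hg : ¬ Good α δ t h) :
    ∃ i j, i < j ∧ Failed α δ i j t h := by
  induction t with
  | zero => exact absurd trivial hg
  | succ t ih =>
    by_cases hg' : Good α δ t (Fin.init h)
    · simp only [Good, hg', true_and, not_forall, not_not] at hg
      obtain ⟨i, j, hij, hd⟩ := hg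
      exact ⟨i, j, hij, Or.inr ⟨hg', hd⟩⟩
    · obtain ⟨i, j, hij, hf⟩ := ih hg'
      exact ⟨i, j, hij, Or.inl hf⟩

theorem not_good_of_failed {i j : Fin L} (hij : i < j) {t : ℕ} {h : History L t}
    (hf : Failed α δ i j t h) : ¬ Good α δ t h := by
  induction t with
  | zero => exact hf.elim
  | succ t ih =>
    rcases hf with hf | hf
    · exact fun hg => ih hf hg.1
    · exact fun hg => hg.2 i j hij hf.2

/-- As long as no statistic has deviated, the relation contains no wrong arrow: a wrong arrow
would need a deviation, because the drift of `S_{ij}` is positive for `i < j`. -/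
theorem Good.sound (hA : Assumptions K α v) (hα : StrictAnti α) {t : ℕ} {h : History L t}
    (hg : Good α δ t h) : Sound (state δ t h).G := by
  induction t with
  | zero => exact fun p hp => hp.elim
  | succ t ih =>
    rintro ⟨j, i⟩ hp
    rcases hp with hp | hp
    · exact ih hg.1 _ hp
    · by_contra! hji
      replace hji : j ≤ i := hji
      change √(2 * ((state δ (t + 1) h).N i j : ℝ) *
          Real.log (c / δ * √((state δ (t + 1) h).N i j : ℝ))) ≤ ((state δ (t + 1) h).S i j : ℝ)
        ∧ 0 < (state δ (t + 1) h).N i j at hp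
      obtain ⟨h1, h2⟩ := hp
      rcases hji.eq_or_lt with rfl | hlt
      · -- the statistics of an item against itself vanish
        have hS : (state δ (t + 1) h).S j j = 0 := by
          have := state_S_swap (δ := δ) h j j
          omega
        have : ∀ t (h : History L t), (state δ t h).N j j = 0 := by
          intro t
          induction t with
          | zero => simp [state]
          | succ t ih =>
            intro h
            rw [state_succ]
            simp [State.update, ih, clickDiff]
        exact h2.ne' (this _ h)
      · refine hg.2 j i hlt ⟨?_, ?_⟩
        · rw [state_N_swap]
          exact h2
        · rw [state_N_swap h i j, state_S_swap h i j]
          have hm := relGap_pos hA hα hlt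
          have h2' : (0 : ℝ) < (state δ (t + 1) h).N i j := by exact_mod_cast h2
          have := mul_pos hm h2'
          push_cast
          linarith

/-- Ville's inequality for the mixture of the exponential supermartingales, stopped when a
statistic deviates. -/
theorem expectation_failed_le (hA : Assumptions K α v) (hα : StrictAnti α)
    (hu : user.HasClickFunction v) (fallback : Policy L) (hδ : 0 < δ)
    {i j : Fin L} (hij : i < j) (t : ℕ) :
    expectation (law user (topRank δ fallback) t) (fun h => if Failed α δ i j t h then 1 else 0)
      ≤ δ / 2 := by
  set F : ∀ t, History L t → ℝ := fun t h => if Failed α δ i j t h then 1 else 0 with hF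
  set M : ∀ t, History L t → ℝ := fun t h =>
    mixture (relGap α i j * (state δ t h).N i j - (state δ t h).S i j) ((state δ t h).N i j) with hM
  set Z : ∀ t, History L t → ℝ := fun t h =>
    (if Good α δ t h then M t h else 0) + 2 / δ * F t h with hZ
  -- `Z` is a supermartingale: at the first deviation of the pair the mixture is at least `2 / δ`
  have key : ∀ t, expectation (law user (topRank δ fallback) t) (Z t) ≤ 1 := by
    intro t
    induction t with
    | zero =>
      rw [expectation_law_zero]
      simp [hZ, hF, hM, Good, Failed, state, mixture_zero]
    | succ t ih =>
      set W : History L t → Clicks L → ℝ := fun h x => if Good α δ t h then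
        mixture ((relGap α i j * (state δ t h).N i j - (state δ t h).S i j)
            + (relGap α i j * |(clickDiff (state δ t h).G x i j : ℝ)|
                - clickDiff (state δ t h).G x i j))
          ((state δ t h).N i j + |(clickDiff (state δ t h).G x i j : ℝ)|)
        else 2 / δ * F t h with hW
      calc expectation (law user (topRank δ fallback) (t + 1)) (Z (t + 1))
          ≤ expectation (law user (topRank δ fallback) (t + 1))
              (fun h => W (Fin.init h) (h (Fin.last t)).2) := by
            refine expectation_mono _ fun h => ?_
            by_cases hg : Good α δ t (Fin.init h)
            · have hnf : ¬ Failed α δ i j t (Fin.init h) := fun hf => not_good_of_failed hij hf hg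
              have hMW : W (Fin.init h) (h (Fin.last t)).2 = M (t + 1) h := by
                simp only [hW, hM, if_pos hg, state_succ, State.update]
                push_cast
                congr 1
                ring
              rw [hMW]
              by_cases hd : Deviates α δ (state δ (t + 1) h) i j
              · have hf : Failed α δ i j (t + 1) h := Or.inr ⟨hg, hd⟩
                have hng := not_good_of_failed hij hf
                simp only [hZ, hF, if_neg hng, if_pos hf, zero_add, mul_one]
                have hN : (1 : ℝ) ≤ (state δ (t + 1) h).N i j := by exact_mod_cast hd.1
                refine two_div_le_mixture hδ hN ?_ hd.2
                have h1 : (-(state δ (t + 1) h).S i j : ℝ) ≤ (state δ (t + 1) h).N i j := by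
                  exact_mod_cast (neg_le_abs _).trans (abs_state_S_le (δ := δ) h i j)
                nlinarith [relGap_le_one hA hα hij]
              · have hf : ¬ Failed α δ i j (t + 1) h := by
                  rintro (hf | hf)
                  exacts [hnf hf, hd hf.2]
                simp only [hZ, hF, if_neg hf, mul_zero, add_zero]
                split_ifs
                · exact le_rfl
                · exact mixture_nonneg _ _
            · have hng : ¬ Good α δ (t + 1) h := fun hg' => hg hg'.1
              have hfi : Failed α δ i j (t + 1) h ↔ Failed α δ i j t (Fin.init h) :=
                ⟨fun hf => hf.elim id fun hf => absurd hf.1 hg, Or.inl⟩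
              simp only [hZ, hW, hF, if_neg hng, if_neg hg, hfi, zero_add, le_refl]
        _ = expectation (law user (topRank δ fallback) t)
              (fun h => roundMean user (topRank δ fallback) h (W h)) :=
            expectation_law_succ _ _ _ fun h a x => by rw [Fin.init_snoc, Fin.snoc_last]
        _ ≤ expectation (law user (topRank δ fallback) t) (Z t) := by
            refine expectation_mono _ fun h => ?_
            by_cases hg : Good α δ t h
            · have hnf : ¬ Failed α δ i j t h := fun hf => not_good_of_failed hij hf hg
              simp only [hW, hZ, hF, if_pos hg, if_neg hnf, mul_zero, add_zero]
              exact roundMean_mixture_le _ _ _ fun l hl =>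
                roundMean_exp_le_one fallback hA hα hu (hg.sound hA hα).acyclic hij hl
            · simp only [hW, hZ, if_neg hg, zero_add, roundMean_const, le_refl]
        _ ≤ 1 := ih
  have h1 : 2 / δ * expectation (law user (topRank δ fallback) t) (F t) ≤ 1 := by
    rw [← expectation_const_mul]
    refine (expectation_mono _ fun h => ?_).trans (key t)
    simp only [hZ]
    split_ifs
    · exact le_add_of_nonneg_left (mixture_nonneg _ _)
    · exact le_add_of_nonneg_left le_rfl
  rw [div_mul_eq_mul_div, div_le_one hδ] at h1
  linarith

theorem expectation_not_good_le (hA : Assumptions K α v) (hα : StrictAnti α)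
    (hu : user.HasClickFunction v) (fallback : Policy L) (hδ : 0 < δ) (t : ℕ) :
    expectation (law user (topRank δ fallback) t) (fun h => if Good α δ t h then 0 else 1)
      ≤ δ / 2 * (L * (L - 1)) := by
  set s : Finset (Fin L × Fin L) := Finset.univ.filter fun p => p.1 < p.2 with hs
  have hcard : (s.card : ℝ) ≤ L * (L - 1) := by
    have hsub : s ⊆ (Finset.univ : Finset (Fin L)).offDiag := fun p hp => by
      simp only [hs, Finset.mem_filter] at hp
      simpa using hp.2.ne
    have hle := Finset.card_le_card hsub
    rw [Finset.offDiag_card, Finset.card_univ, Fintype.card_fin] at hle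
    have : s.card + L ≤ L * L := by
      have := Nat.le_mul_self L
      omega
    have : (s.card : ℝ) + L ≤ L * L := by exact_mod_cast this
    linarith
  calc expectation (law user (topRank δ fallback) t) (fun h => if Good α δ t h then 0 else 1)
      ≤ expectation (law user (topRank δ fallback) t)
          (fun h => ∑ p ∈ s, if Failed α δ p.1 p.2 t h then (1 : ℝ) else 0) := by
        refine expectation_mono _ fun h => ?_
        have hnn : ∀ p ∈ s, 0 ≤ if Failed α δ p.1 p.2 t h then (1 : ℝ) else 0 := fun p _ => by
          split_ifs <;> norm_num
        split_ifs with hg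
        · exact Finset.sum_nonneg hnn
        · obtain ⟨i, j, hij, hf⟩ := exists_failed_of_not_good hg
          have := Finset.single_le_sum hnn (Finset.mem_filter.2 ⟨Finset.mem_univ (i, j), hij⟩)
          simpa only [if_pos hf] using this
    _ ≤ ∑ p ∈ s, δ / 2 := by
        rw [expectation_sum]
        exact Finset.sum_le_sum fun p hp =>
          expectation_failed_le hA hα hu fallback hδ (Finset.mem_filter.1 hp).2 t
    _ ≤ δ / 2 * (L * (L - 1)) := by
        rw [Finset.sum_const, nsmul_eq_mul, mul_comm]
        gcongr

end Failure

/-! ### Regret up to the first deviation -/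

section Stopped

variable {L K : ℕ} {α : Fin L → ℝ} {v : Action L → Fin L → ℝ} {user : User L} {δ : ℝ}

/-- The sum of `φ (U_{sij})` over the rounds `s` up to the first deviation of a statistic. -/
def stoppedSum (α : Fin L → ℝ) (δ : ℝ) (i j : Fin L) (φ : ℤ → ℤ) : ∀ t : ℕ, History L t → ℤ
  | 0, _ => 0
  | t + 1, h => stoppedSum α δ i j φ t (Fin.init h) +
      if Good α δ t (Fin.init h) then φ (clickDiff (state δ t (Fin.init h)).G (h (Fin.last t)).2 i j)
      else 0

theorem expectation_stoppedSum_succ (α : Fin L → ℝ) (i j : Fin L) (φ : ℤ → ℤ) (π : Policy L)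
    (t : ℕ) :
    expectation (law user π (t + 1)) (fun h => (stoppedSum α δ i j φ (t + 1) h : ℝ))
      = expectation (law user π t) (fun h => (stoppedSum α δ i j φ t h : ℝ))
        + expectation (law user π t) (fun h => roundMean user π h fun x =>
            if Good α δ t h then (φ (clickDiff (state δ t h).G x i j) : ℝ) else 0) := by
  rw [← expectation_add]
  rw [expectation_law_succ user π t (g := fun h x => (stoppedSum α δ i j φ t h : ℝ) +
    if Good α δ t h then (φ (clickDiff (state δ t h).G x i j) : ℝ) else 0)]
  · simp only [roundMean_add, roundMean_const]
  · intro h a x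
    simp only [stoppedSum, Fin.init_snoc, Fin.snoc_last]
    push_cast
    rfl

/-- The regret is paid for by failures and by the differences of clicks before the first failure. -/
theorem regret_le_stopped (hA : Assumptions K α v) (hα : StrictAnti α)
    (hu : user.HasClickFunction v) (fallback : Policy L) (hδ : 0 < δ) (t : ℕ) :
    regret K v user (topRank δ fallback) t ≤ t * (K * (δ / 2 * (L * (L - 1))))
      + ∑ j : Fin L, ∑ i : Fin L with i < j ∧ i.val < K,
          expectation (law user (topRank δ fallback) t)
            (fun h => (stoppedSum α δ i j id t h : ℝ)) := by
  set π := topRank δ fallback with hπ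
  induction t with
  | zero =>
    simp only [regret, expectation_law_zero]
    simp [stoppedSum]
  | succ t ih =>
    have hclicks : expectation (law user π (t + 1)) (fun h => ∑ s, (totalClicks (h s).2 : ℝ))
        = expectation (law user π t) (fun h => ∑ s, (totalClicks (h s).2 : ℝ))
          + expectation (law user π t)
              (fun h => roundMean user π h fun x => (totalClicks x : ℝ)) := by
      rw [← expectation_add, expectation_law_succ user π t (g := fun h x =>
        (∑ s, (totalClicks (h s).2 : ℝ)) + (totalClicks x : ℝ))]
      · simp only [roundMean_add, roundMean_const]
      · intro h a x
        simp only [Fin.sum_univ_castSucc, Fin.snoc_castSucc, Fin.snoc_last]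
    have hround : ∀ h : History L t, maxValue K v
        - roundMean user π h (fun x => (totalClicks x : ℝ))
        ≤ K * (if Good α δ t h then 0 else 1) + ∑ j : Fin L, ∑ i : Fin L with i < j ∧ i.val < K,
            roundMean user π h fun x =>
              if Good α δ t h then (id (clickDiff (state δ t h).G x i j) : ℝ) else 0 := by
      intro h
      rw [maxValue_eq hA hα]
      by_cases hg : Good α δ t h
      · have hG := hg.sound hA hα
        have h1 : roundMean user π h (fun x => (totalClicks x : ℝ))
            = ∑ i, meanClick v (state δ t h).G i := by
          simp only [totalClicks, Int.cast_sum, roundMean_sum, hπ,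
            roundMean_click fallback hu hG.acyclic]
        simp only [if_pos hg, mul_zero, zero_add, id, h1]
        simp only [hπ, roundMean_clickDiff fallback hu hG.acyclic]
        exact value_sub_sum_meanClick_le hA hα hG
      · have h1 : 0 ≤ roundMean user π h (fun x => (totalClicks x : ℝ)) :=
          roundMean_nonneg _ _ _ fun x => by
            exact_mod_cast Finset.sum_nonneg fun i _ => click_nonneg (x i)
        have h2 := value_le hA 1
        simp only [if_neg hg, roundMean_const, Finset.sum_const_zero, mul_one, add_zero]
        linarith
    have hstep := expectation_mono (law user π t) hround
    rw [expectation_sub, expectation_const, expectation_add, expectation_const_mul] at hstep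
    simp only [expectation_sum] at hstep
    have hfail := mul_le_mul_of_nonneg_left
      (expectation_not_good_le hA hα hu fallback hδ t) (Nat.cast_nonneg K)
    simp only [expectation_stoppedSum_succ, Finset.sum_add_distrib]
    simp only [regret, id] at ih hstep ⊢
    rw [hclicks]
    push_cast
    linarith

/-- In one round, the pairs with a good item compare at most `2 K ^ 2` clicks in expectation: by
symmetry an item is clicked at most `K / |P|` times if it is in a block `P`. -/
theorem sum_roundMean_abs_clickDiff_le (hA : Assumptions K α v) (hu : user.HasClickFunction v)
    (fallback : Policy L) {t : ℕ} {h : History L t} (hG : Acyclic (state δ t h).G) :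
    ∑ j : Fin L, ∑ i : Fin L with i < j ∧ i.val < K,
        roundMean user (topRank δ fallback) h (fun x => (|clickDiff (state δ t h).G x i j| : ℝ))
      ≤ 2 * (K : ℝ) ^ 2 := by
  set G := (state δ t h).G
  have hnn := fun i => meanClick_nonneg (G := G) hA i
  calc _ ≤ ∑ j : Fin L, ∑ i : Fin L with i.val < K,
        if SameBlock G i j then meanClick v G i + meanClick v G j else 0 := by
        refine Finset.sum_le_sum fun j _ => (Finset.sum_le_sum fun i _ =>
          roundMean_abs_clickDiff_le fallback hu hG i j).trans ?_
        refine Finset.sum_le_sum_of_subset_of_nonneg (fun i hi => ?_) fun i _ _ => ?_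
        · simp only [Finset.mem_filter] at hi ⊢
          exact ⟨hi.1, hi.2.2⟩
        · split_ifs
          · exact add_nonneg (hnn i) (hnn j)
          · exact le_rfl
    _ = ∑ i : Fin L with i.val < K, ∑ j : Fin L with SameBlock G i j,
        (meanClick v G i + meanClick v G j) := by
        rw [Finset.sum_comm]
        simp only [Finset.sum_filter]
    _ ≤ ∑ i : Fin L with i.val < K, (2 * K : ℝ) := by
        refine Finset.sum_le_sum fun i _ => ?_
        rw [Finset.sum_add_distrib, two_mul]
        refine add_le_add (sum_block_meanClick_le hA hG i) (le_trans ?_ (sum_meanClick_le hA hG))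
        exact Finset.sum_le_sum_of_subset_of_nonneg (Finset.filter_subset _ _) fun j _ _ => hnn j
    _ ≤ K * (2 * K : ℝ) := by
        rw [Finset.sum_const, nsmul_eq_mul]
        gcongr
        exact card_filter_val_lt_le K
    _ = 2 * (K : ℝ) ^ 2 := by ring

theorem sum_expectation_stoppedSum_abs_le (hA : Assumptions K α v) (hα : StrictAnti α)
    (hu : user.HasClickFunction v) (fallback : Policy L) (t : ℕ) :
    ∑ j : Fin L, ∑ i : Fin L with i < j ∧ i.val < K,
        expectation (law user (topRank δ fallback) t)
          (fun h => (stoppedSum α δ i j (fun u => |u|) t h : ℝ)) ≤ t * (2 * (K : ℝ) ^ 2) := by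
  induction t with
  | zero => simp [expectation_law_zero, stoppedSum]
  | succ t ih =>
    have hround : ∀ h : History L t, ∑ j : Fin L, ∑ i : Fin L with i < j ∧ i.val < K,
        roundMean user (topRank δ fallback) h (fun x =>
          if Good α δ t h then ((|clickDiff (state δ t h).G x i j| : ℤ) : ℝ) else 0)
        ≤ 2 * (K : ℝ) ^ 2 := by
      intro h
      by_cases hg : Good α δ t h
      · simp only [if_pos hg, Int.cast_abs]
        exact sum_roundMean_abs_clickDiff_le hA hu fallback (hg.sound hA hα).acyclic
      · simp only [if_neg hg, roundMean_const, Finset.sum_const_zero]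
        positivity
    have hstep := expectation_mono (law user (topRank δ fallback) t) hround
    rw [expectation_const] at hstep
    simp only [expectation_sum] at hstep
    simp only [expectation_stoppedSum_succ, Finset.sum_add_distrib]
    push_cast at hstep ⊢
    linarith

theorem stoppedSum_abs_nonneg (i j : Fin L) (t : ℕ) (h : History L t) :
    0 ≤ stoppedSum α δ i j (fun u => |u|) t h := by
  induction t with
  | zero => exact le_rfl
  | succ t ih =>
    refine add_nonneg (ih _) ?_
    split_ifs
    · exact abs_nonneg _
    · exact le_rfl

theorem stoppedSum_of_good (i j : Fin L) {t : ℕ} {h : History L t} (hg : Good α δ t h) :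
    stoppedSum α δ i j id t h = (state δ t h).S i j
      ∧ stoppedSum α δ i j (fun u => |u|) t h = (state δ t h).N i j := by
  induction t with
  | zero => exact ⟨rfl, rfl⟩
  | succ t ih =>
    obtain ⟨h1, h2⟩ := ih hg.1
    simp only [stoppedSum, if_pos hg.1, h1, h2]
    exact ⟨rfl, rfl⟩

theorem log_arg_pos {n : ℕ} (hn : 1 ≤ n) (hδ : 0 < δ) (hδ1 : δ < 1) :
    0 < Real.log (c * √n / δ) := by
  have hc := two_le_c
  have h1 : 1 ≤ √(n : ℝ) := Real.one_le_sqrt.2 (by exact_mod_cast hn)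
  refine Real.log_pos ((one_lt_div hδ).2 ?_)
  nlinarith

/-- While the arrow `(j, i)` is missing, `S_{ij}` is below the confidence width; as it also has not
fallen short of its drift, `N_{ij}` is small. -/
theorem stats_lt_of_not_mem (hA : Assumptions K α v) (hα : StrictAnti α) (hδ : 0 < δ) (hδ1 : δ < 1)
    {i j : Fin L} (hij : i < j) {n t : ℕ} (hn : 1 ≤ n) (ht : t ≤ n) {h : History L t}
    (hg : Good α δ t h) (hji : (j, i) ∉ (state δ t h).G) :
    ((state δ t h).S i j : ℝ) ≤ √(2 * (state δ t h).N i j * Real.log (c * √n / δ)) ∧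
    ((state δ t h).S i j : ℝ) ≤ 4 * Real.log (c * √n / δ) / relGap α i j := by
  set ℓ := Real.log (c * √n / δ) with hℓ
  have hℓ0 : 0 < ℓ := log_arg_pos hn hδ hδ1
  have hm := relGap_pos hA hα hij
  set m := relGap α i j with hmdef
  cases t with
  | zero =>
    simp only [state, Int.cast_zero, mul_zero, zero_mul, Real.sqrt_zero, le_refl, true_and]
    positivity
  | succ t =>
    have hN0 : 0 ≤ (state δ (t + 1) h).N i j :=
      (abs_nonneg _).trans (abs_state_S_le (δ := δ) h i j)
    rcases hN0.eq_or_lt with hN | hN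
    · have hS := abs_state_S_le (δ := δ) h i j
      rw [← hN, abs_nonpos_iff] at hS
      rw [hS, Int.cast_zero]
      exact ⟨Real.sqrt_nonneg _, by positivity⟩
    have hnp : ¬ (((state δ (t + 1) h).S i j : ℝ) ≥ √(2 * (state δ (t + 1) h).N i j *
        Real.log (c / δ * √((state δ (t + 1) h).N i j))) ∧ (state δ (t + 1) h).N i j > 0) :=
      fun hp => hji (Or.inr hp)
    have hnd : ¬ (0 < (state δ (t + 1) h).N i j ∧ √(2 * (state δ (t + 1) h).N i j *
        Real.log (c / δ * √((state δ (t + 1) h).N i j)))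
        ≤ m * (state δ (t + 1) h).N i j - (state δ (t + 1) h).S i j) := hg.2 i j hij
    simp only [hN, and_true, true_and, ge_iff_le, not_le] at hnp hnd
    have hNR : (1 : ℝ) ≤ (state δ (t + 1) h).N i j := by exact_mod_cast hN
    have hNn : ((state δ (t + 1) h).N i j : ℝ) ≤ n := by
      have := (state_N_le (δ := δ) h i j).trans (Int.ofNat_le.2 ht)
      exact_mod_cast this
    set S : ℝ := ((state δ (t + 1) h).S i j : ℝ)
    set N : ℝ := ((state δ (t + 1) h).N i j : ℝ)
    have hc0 : 0 < c := by linarith [two_le_c]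
    have hwidth : √(2 * N * Real.log (c / δ * √N)) ≤ √(2 * N * ℓ) := by
      refine Real.sqrt_le_sqrt (mul_le_mul_of_nonneg_left ?_ (by linarith))
      refine Real.log_le_log (by positivity) ?_
      rw [div_mul_eq_mul_div]
      gcongr
    set w := √(2 * N * ℓ) with hw
    have hw2 : w ^ 2 = 2 * N * ℓ := Real.sq_sqrt (by positivity)
    have hw0 : 0 < w := Real.sqrt_pos.2 (by positivity)
    refine ⟨by linarith, ?_⟩
    -- `m N < 2 w` and `w ^ 2 = 2 N ℓ` give `m w < 4 ℓ`
    have h1 : m * N < 2 * w := by linarith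
    have h2 : m * w * w < 4 * ℓ * w := by nlinarith
    have h3 : m * w < 4 * ℓ := lt_of_mul_lt_mul_right h2 hw0.le
    rw [le_div_iff₀ hm]
    nlinarith

/-- Once the arrow `(j, i)` is present, items `i` and `j` are never compared again, so that the sum
of differences exceeds its last value without the arrow by at most `1`. -/
theorem stoppedSum_le (hA : Assumptions K α v) (hα : StrictAnti α) (hδ : 0 < δ) (hδ1 : δ < 1)
    {i j : Fin L} (hij : i < j) {n : ℕ} (hn : 1 ≤ n) :
    ∀ {t : ℕ}, t ≤ n → ∀ h : History L t,
      (stoppedSum α δ i j id t h : ℝ)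
          ≤ 1 + √(2 * stoppedSum α δ i j (fun u => |u|) t h * Real.log (c * √n / δ)) ∧
      (stoppedSum α δ i j id t h : ℝ) ≤ 1 + 4 * Real.log (c * √n / δ) / relGap α i j := by
  have hℓ0 := log_arg_pos hn hδ hδ1
  have hm := relGap_pos hA hα hij
  intro t
  induction t with
  | zero =>
    intro _ h
    simp only [stoppedSum, Int.cast_zero]
    exact ⟨by positivity, by positivity⟩
  | succ t ih =>
    intro ht h
    have ih := ih (by omega) (Fin.init h)
    have hcase : ¬ Good α δ t (Fin.init h) ∨ (j, i) ∈ (state δ t (Fin.init h)).G ∨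
        (Good α δ t (Fin.init h) ∧ (j, i) ∉ (state δ t (Fin.init h)).G) := by tauto
    rcases hcase with hg | hG | ⟨hg, hG⟩
    · simpa only [stoppedSum, if_neg hg, add_zero] using ih
    · simpa only [stoppedSum, clickDiff, if_neg (not_sameBlock hG), id, abs_zero, ite_self,
        add_zero] using ih
    · have hst := stats_lt_of_not_mem hA hα hδ hδ1 hij hn (by omega) hg hG
      obtain ⟨hS, hN⟩ := stoppedSum_of_good i j hg
      rw [← hS, ← hN] at hst
      have hS1 : stoppedSum α δ i j id (t + 1) h ≤ 1 + stoppedSum α δ i j id t (Fin.init h) := by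
        simp only [stoppedSum, if_pos hg, id]
        rcases clickDiff_trichotomy (state δ t (Fin.init h)).G (h (Fin.last t)).2 i j
          with h0 | h0 | h0 <;> rw [h0] <;> omega
      have hN1 : stoppedSum α δ i j (fun u => |u|) t (Fin.init h)
          ≤ stoppedSum α δ i j (fun u => |u|) (t + 1) h := by
        simp only [stoppedSum, if_pos hg]
        exact le_add_of_nonneg_right (abs_nonneg _)
      have hS1' : (stoppedSum α δ i j id (t + 1) h : ℝ)
          ≤ 1 + stoppedSum α δ i j id t (Fin.init h) := by exact_mod_cast hS1
      have hN1' : (stoppedSum α δ i j (fun u => |u|) t (Fin.init h) : ℝ)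
          ≤ stoppedSum α δ i j (fun u => |u|) (t + 1) h := by exact_mod_cast hN1
      have hmono : √(2 * stoppedSum α δ i j (fun u => |u|) t (Fin.init h)
            * Real.log (c * √n / δ))
          ≤ √(2 * stoppedSum α δ i j (fun u => |u|) (t + 1) h * Real.log (c * √n / δ)) := by
        refine Real.sqrt_le_sqrt ?_
        gcongr
      exact ⟨by linarith [hst.1], by linarith [hst.2]⟩

end Stopped

/-! ### The two regret bounds -/

section Bounds

variable {L K : ℕ} {α : Fin L → ℝ} {v : Action L → Fin L → ℝ} {user : User L} {δ : ℝ}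

theorem regret_le_gap (hA : Assumptions K α v) (hα : StrictAnti α) (hu : user.HasClickFunction v)
    (fallback : Policy L) (hδ : 0 < δ) (hδ1 : δ < 1) {n : ℕ} (hn : 1 ≤ n) :
    regret K v user (topRank δ fallback) n ≤ n * (K * (δ / 2 * (L * (L - 1))))
      + ∑ j : Fin L, ∑ i : Fin L with i < j ∧ i.val < K,
          (1 + 6 * (α i + α j) * Real.log (c * √(n : ℝ) / δ) / (α i - α j)) := by
  refine (regret_le_stopped hA hα hu fallback hδ n).trans ?_
  gcongr with j _ i hi
  have hij := (Finset.mem_filter.1 hi).2.1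
  have hℓ := log_arg_pos hn hδ hδ1
  refine (expectation_mono _ fun h => (stoppedSum_le hA hα hδ hδ1 hij hn le_rfl h).2).trans ?_
  rw [expectation_const, relGap, div_div_eq_mul_div]
  have h1 := sub_pos.2 (hα hij)
  have h2 := hA.sum_pos hα hij
  gcongr 1 + ?_ / _
  nlinarith [mul_pos h2 hℓ]

theorem sum_pairs_one_le : ∑ j : Fin L, ∑ i : Fin L with i < j ∧ i.val < K, (1 : ℝ) ≤ K * L := by
  calc ∑ j : Fin L, ∑ i : Fin L with i < j ∧ i.val < K, (1 : ℝ) ≤ ∑ _j : Fin L, (K : ℝ) := by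
        refine Finset.sum_le_sum fun j _ => ?_
        rw [Finset.sum_const, nsmul_eq_mul, mul_one]
        refine Nat.cast_le.2 (le_trans (Finset.card_le_card fun i hi => ?_)
          (card_filter_val_lt_le (L := L) K))
        simp only [Finset.mem_filter] at hi ⊢
        exact ⟨hi.1, hi.2.2⟩
    _ = K * L := by
        rw [Finset.sum_const, Finset.card_univ, Fintype.card_fin, nsmul_eq_mul, mul_comm]

theorem regret_le_sqrt (hA : Assumptions K α v) (hα : StrictAnti α) (hu : user.HasClickFunction v)
    (fallback : Policy L) (hδ : 0 < δ) (hδ1 : δ < 1) {n : ℕ} (hn : 1 ≤ n) :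
    regret K v user (topRank δ fallback) n ≤ n * (K * (δ / 2 * (L * (L - 1)))) + K * L
      + √(4 * (K : ℝ) ^ 3 * L * n * Real.log (c * √(n : ℝ) / δ)) := by
  refine (regret_le_stopped hA hα hu fallback hδ n).trans ?_
  rw [add_assoc]
  gcongr
  rcases Nat.eq_zero_or_pos K with rfl | hK
  · simp
  rcases Nat.eq_zero_or_pos L with rfl | hL
  · simp
  have hℓ := log_arg_pos hn hδ hδ1
  set ℓ := Real.log (c * √(n : ℝ) / δ)
  have hKR : (0 : ℝ) < K := by exact_mod_cast hK
  have hLR : (0 : ℝ) < L := by exact_mod_cast hL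
  have hnR : (0 : ℝ) < n := by exact_mod_cast hn
  set X := √(4 * (K : ℝ) ^ 3 * L * n * ℓ) with hX
  have hX0 : 0 < X := Real.sqrt_pos.2 (by positivity)
  have hX2 : X ^ 2 = 4 * (K : ℝ) ^ 3 * L * n * ℓ := Real.sq_sqrt (by positivity)
  -- the weight that balances the two terms of the arithmetic mean, summed over all pairs
  set θ := X / (K * L) with hθ
  have hθ0 : 0 < θ := by positivity
  have hterm : ∀ j : Fin L, ∀ i ∈ Finset.univ.filter (fun i : Fin L => i < j ∧ i.val < K),
      expectation (law user (topRank δ fallback) n) (fun h => (stoppedSum α δ i j id n h : ℝ))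
        ≤ (1 + θ / 2) * 1 + ℓ / θ * expectation (law user (topRank δ fallback) n)
            (fun h => (stoppedSum α δ i j (fun u => |u|) n h : ℝ)) := by
    intro j i hi
    have hij := (Finset.mem_filter.1 hi).2.1
    rw [← expectation_const_mul, mul_one, ← expectation_const (law user (topRank δ fallback) n)
      (1 + θ / 2), ← expectation_add]
    refine expectation_mono _ fun h => (stoppedSum_le hA hα hδ hδ1 hij hn le_rfl h).1.trans ?_
    have hN : (0 : ℝ) ≤ stoppedSum α δ i j (fun u => |u|) n h := by
      exact_mod_cast stoppedSum_abs_nonneg i j n h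
    set N : ℝ := (stoppedSum α δ i j (fun u => |u|) n h : ℝ)
    rw [add_assoc]
    gcongr
    have hw2 : √(2 * N * ℓ) ^ 2 = 2 * N * ℓ := Real.sq_sqrt (by positivity)
    have hamgm : √(2 * N * ℓ) * θ ≤ (θ / 2 + ℓ / θ * N) * θ := by
      have : (θ / 2 + ℓ / θ * N) * θ = (θ ^ 2 + 2 * N * ℓ) / 2 := by
        field_simp
      rw [this]
      linarith [hw2, two_mul_le_add_sq (√(2 * N * ℓ)) θ]
    exact le_of_mul_le_mul_right hamgm hθ0
  refine (Finset.sum_le_sum fun j _ => Finset.sum_le_sum (hterm j)).trans ?_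
  simp only [Finset.sum_add_distrib, ← Finset.mul_sum]
  have h1 := mul_le_mul_of_nonneg_left (sum_pairs_one_le (L := L) (K := K))
    (show 0 ≤ 1 + θ / 2 by positivity)
  have h2 := mul_le_mul_of_nonneg_left
    (sum_expectation_stoppedSum_abs_le (δ := δ) hA hα hu fallback n)
    (show 0 ≤ ℓ / θ by positivity)
  have h3 : (1 + θ / 2) * (K * L) = K * L + X / 2 := by
    rw [hθ]
    field_simp
  have h4 : ℓ / θ * (n * (2 * (K : ℝ) ^ 2)) = X / 2 := by
    rw [hθ]
    field_simp
    linarith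
  linarith

end Bounds

/-! ### Consequences for `δ = 1 / n` -/

theorem log_le_of_delta_eq {n : ℕ} (hn : 3 ≤ n) (hc : c ≤ n) :
    Real.log (c * √(n : ℝ) / (1 / n)) ≤ 5 / 2 * Real.log n := by
  have hn0 : (0 : ℝ) < n := by positivity
  have hc0 : 0 < c := by linarith [two_le_c]
  have h1 := Real.log_le_log hc0 hc
  rw [div_div_eq_mul_div, div_one, Real.log_mul (by positivity) hn0.ne',
    Real.log_mul hc0.ne' (by positivity), Real.log_sqrt hn0.le]
  linarith

/-- The failure term of the regret bounds when `δ = 1 / n`. -/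
theorem failure_term_eq {n : ℕ} (hn : 1 ≤ n) (K L : ℕ) :
    (n : ℝ) * (K * (1 / (n : ℝ) / 2 * (L * (L - 1)))) = K * (L * (L - 1)) / 2 := by
  have : (n : ℝ) ≠ 0 := by positivity
  field_simp

section Asymptotics

variable {L K : ℕ} {α : Fin L → ℝ} {v : Action L → Fin L → ℝ} {user : User L}

theorem regret_le_gap_log (hA : Assumptions K α v) (hα : StrictAnti α)
    (hu : user.HasClickFunction v) (fallback : Policy L) {n : ℕ} (hn : 3 ≤ n) (hc : c ≤ n)
    (hlog : (K : ℝ) * L ^ 2 ≤ Real.log n) :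
    regret K v user (topRank (1 / (n : ℝ)) fallback) n
      ≤ 32 * ∑ j : Fin L, ∑ i : Fin L with i < j ∧ i.val < K,
          α i * Real.log n / (α i - α j) := by
  have hn1 : (1 : ℝ) < n := by exact_mod_cast (by omega : 1 < n)
  have hδ : (0 : ℝ) < 1 / n := by positivity
  have hδ1 : (1 : ℝ) / n < 1 := (div_lt_one (by linarith)).2 hn1
  have hreg := regret_le_gap hA hα hu fallback hδ hδ1 (by omega : 1 ≤ n)
  rw [failure_term_eq (by omega)] at hreg
  have hℓ := log_le_of_delta_eq hn hc
  set ℓ := Real.log (c * √(n : ℝ) / (1 / n))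
  have hlog1 : 1 ≤ Real.log n := by
    rw [Real.le_log_iff_exp_le (by linarith)]
    have : (3 : ℝ) ≤ n := by exact_mod_cast hn
    linarith [Real.exp_one_lt_three]
  have hterm : ∀ {i j : Fin L}, i < j → Real.log n ≤ α i * Real.log n / (α i - α j) := by
    intro i j hij
    have h1 := sub_pos.2 (hα hij)
    rw [le_div_iff₀ h1, mul_comm]
    gcongr
    linarith [(hA.attractiveness_mem j).1]
  have hsum : ∑ j : Fin L, ∑ i : Fin L with i < j ∧ i.val < K,
        (1 + 6 * (α i + α j) * ℓ / (α i - α j))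
      ≤ 31 * ∑ j : Fin L, ∑ i : Fin L with i < j ∧ i.val < K,
          α i * Real.log n / (α i - α j) := by
    simp only [Finset.mul_sum]
    refine Finset.sum_le_sum fun j _ => Finset.sum_le_sum fun i hi => ?_
    have hij := (Finset.mem_filter.1 hi).2.1
    have h1 := sub_pos.2 (hα hij)
    have h2 := hA.sum_pos hα hij
    have h3 : 6 * (α i + α j) * ℓ / (α i - α j) ≤ 30 * (α i * Real.log n / (α i - α j)) := by
      rw [← mul_div_assoc]
      refine div_le_div_of_nonneg_right ?_ h1.le
      calc 6 * (α i + α j) * ℓ ≤ 6 * (α i + α j) * (5 / 2 * Real.log n) := by gcongr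
        _ ≤ 6 * (α i + α i) * (5 / 2 * Real.log n) := by
            gcongr
            exact (hα hij).le
        _ = 30 * (α i * Real.log n) := by ring
    linarith [hterm hij]
  have hfail : (K : ℝ) * (L * (L - 1)) / 2 ≤ ∑ j : Fin L, ∑ i : Fin L with i < j ∧ i.val < K,
      α i * Real.log n / (α i - α j) := by
    have hnn : ∀ j : Fin L, ∀ i ∈ Finset.univ.filter (fun i : Fin L => i < j ∧ i.val < K),
        0 ≤ α i * Real.log n / (α i - α j) := fun j i hi =>
      le_trans (by linarith) (hterm (Finset.mem_filter.1 hi).2.1)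
    have hnn' := fun j => Finset.sum_nonneg (hnn j)
    rcases Nat.eq_zero_or_pos K with hK | hK
    · simp only [hK, Nat.cast_zero, zero_mul, zero_div]
      simpa only [hK] using Finset.sum_nonneg fun j (_ : j ∈ Finset.univ) => hnn' j
    rcases Nat.lt_or_ge L 2 with hL | hL
    · have : (L : ℝ) * (L - 1) = 0 := by
        interval_cases L <;> simp
      rw [this]
      simpa using Finset.sum_nonneg fun j (_ : j ∈ Finset.univ) => hnn' j
    · -- there is a pair to pay for the failures
      have h01 : (⟨0, by omega⟩ : Fin L) < ⟨1, by omega⟩ := by simp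
      have h1 := Finset.single_le_sum (hnn ⟨1, by omega⟩)
        (Finset.mem_filter.2 ⟨Finset.mem_univ (⟨0, by omega⟩ : Fin L), h01, hK⟩)
      have h2 := Finset.single_le_sum (fun j _ => hnn' j) (Finset.mem_univ (⟨1, by omega⟩ : Fin L))
      have h3 : (K : ℝ) * (L * (L - 1)) / 2 ≤ K * L ^ 2 := by
        have : (0 : ℝ) ≤ K * L ^ 2 := by positivity
        have : (0 : ℝ) ≤ (K : ℝ) * L := by positivity
        nlinarith
      exact h3.trans (hlog.trans ((hterm h01).trans (h1.trans h2)))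
  linarith

theorem regret_le_sqrt_log (hA : Assumptions K α v) (hα : StrictAnti α)
    (hu : user.HasClickFunction v) (fallback : Policy L) (hKL : K ≤ L) {n : ℕ} (hn : 3 ≤ n)
    (hc : c ≤ n) (hlog : (K : ℝ) * L ^ 2 ≤ Real.log n) :
    regret K v user (topRank (1 / (n : ℝ)) fallback) n
      ≤ 32 * √((K : ℝ) ^ 3 * L * n * Real.log n) := by
  have hn1 : (1 : ℝ) < n := by exact_mod_cast (by omega : 1 < n)
  have hδ : (0 : ℝ) < 1 / n := by positivity
  have hδ1 : (1 : ℝ) / n < 1 := (div_lt_one (by linarith)).2 hn1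
  have hreg := regret_le_sqrt hA hα hu fallback hδ hδ1 (by omega : 1 ≤ n)
  rw [failure_term_eq (by omega)] at hreg
  rcases Nat.eq_zero_or_pos K with rfl | hK
  · simpa using hreg
  have hℓ := log_le_of_delta_eq hn hc
  set ℓ := Real.log (c * √(n : ℝ) / (1 / n))
  have hlog0 : 0 < Real.log n := Real.log_pos hn1
  have hK1 : (1 : ℝ) ≤ K := by exact_mod_cast hK
  have hL1 : (1 : ℝ) ≤ L := by exact_mod_cast hK.trans_le hKL
  set Y := √((K : ℝ) ^ 3 * L * n * Real.log n) with hY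
  have h1 : √(4 * (K : ℝ) ^ 3 * L * n * ℓ) ≤ 4 * Y := by
    have h16 : 4 * (K : ℝ) ^ 3 * L * n * ℓ ≤ 4 ^ 2 * ((K : ℝ) ^ 3 * L * n * Real.log n) := by
      calc 4 * (K : ℝ) ^ 3 * L * n * ℓ
          ≤ 4 * (K : ℝ) ^ 3 * L * n * (5 / 2 * Real.log n) := by gcongr
        _ ≤ 4 ^ 2 * ((K : ℝ) ^ 3 * L * n * Real.log n) := by
            have : 0 ≤ (K : ℝ) ^ 3 * L * n * Real.log n := by positivity
            linarith
    refine (Real.sqrt_le_sqrt h16).trans_eq ?_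
    rw [Real.sqrt_mul (by positivity), Real.sqrt_sq (by norm_num)]
  have h2 : Real.log n ≤ Y := by
    refine Real.le_sqrt_of_sq_le ?_
    have hle : Real.log n ≤ n := (Real.log_le_sub_one_of_pos (by linarith)).trans (by linarith)
    have hKL1 : 1 ≤ (K : ℝ) ^ 3 * L := one_le_mul_of_one_le_of_one_le (one_le_pow₀ hK1) hL1
    calc Real.log n ^ 2 = 1 * Real.log n * Real.log n := by ring
      _ ≤ (K : ℝ) ^ 3 * L * n * Real.log n := by gcongr
  have h3 : (K : ℝ) * (L * (L - 1)) / 2 + K * L ≤ K * L ^ 2 := by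
    have : (0 : ℝ) ≤ K * L * (L - 1) := mul_nonneg (by positivity) (by linarith)
    nlinarith
  have hY0 : 0 ≤ Y := Real.sqrt_nonneg _
  linarith

end Asymptotics

/-- The failure term is at most the one with `L ^ 2` in place of `L * (L - 1) / 2`. -/
theorem failure_term_le {δ : ℝ} (hδ : 0 < δ) (n K L : ℕ) :
    (n : ℝ) * (K * (δ / 2 * (L * (L - 1)))) ≤ δ * n * K * (L : ℝ) ^ 2 := by
  have h1 : (0 : ℝ) ≤ δ * n * K := by positivity
  have h2 : (L : ℝ) * (L - 1) / 2 ≤ L ^ 2 := by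
    have : (0 : ℝ) ≤ L := by positivity
    nlinarith
  calc (n : ℝ) * (K * (δ / 2 * (L * (L - 1)))) = δ * n * K * (L * (L - 1) / 2) := by ring
    _ ≤ _ := mul_le_mul_of_nonneg_left h2 h1

end TopRank

end

theorem theorem1 :
    (∀ (L K n : ℕ), K ≤ L → 1 ≤ n →
      ∀ (α : Fin L → ℝ) (v : TopRank.Action L → Fin L → ℝ),
      TopRank.Assumptions K α v → StrictAnti α →
      ∀ (user : TopRank.User L), user.HasClickFunction v →
      ∀ (fallback : TopRank.Policy L) (δ : ℝ), 0 < δ → δ < 1 →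
        TopRank.regret K v user (TopRank.topRank δ fallback) n
            ≤ δ * n * K * (L : ℝ) ^ 2
              + ∑ j : Fin L, ∑ i : Fin L with i < j ∧ i.val < K,
                  (1 + 6 * (α i + α j) * Real.log (TopRank.c * √(n : ℝ) / δ) / (α i - α j)) ∧
        TopRank.regret K v user (TopRank.topRank δ fallback) n
            ≤ δ * n * K * (L : ℝ) ^ 2 + K * L
              + √(4 * (K : ℝ) ^ 3 * L * n * Real.log (TopRank.c * √(n : ℝ) / δ))) ∧
    (∃ C : ℝ, 0 < C ∧ ∀ (L K : ℕ), K ≤ L → ∃ n₀ : ℕ, ∀ n : ℕ, n₀ ≤ n →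
      ∀ (α : Fin L → ℝ) (v : TopRank.Action L → Fin L → ℝ),
      TopRank.Assumptions K α v → StrictAnti α →
      ∀ (user : TopRank.User L), user.HasClickFunction v →
      ∀ (fallback : TopRank.Policy L),
        TopRank.regret K v user (TopRank.topRank (1 / (n : ℝ)) fallback) n
            ≤ C * ∑ j : Fin L, ∑ i : Fin L with i < j ∧ i.val < K,
                  α i * Real.log n / (α i - α j) ∧
        TopRank.regret K v user (TopRank.topRank (1 / (n : ℝ)) fallback) n
            ≤ C * √((K : ℝ) ^ 3 * L * n * Real.log n)) := by
  constructor
  · intro L K n _ hn α v hA hα user hu fallback δ hδ hδ1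
    have hfail := TopRank.failure_term_le hδ n K L
    have h1 := TopRank.regret_le_gap hA hα hu fallback hδ hδ1 hn
    have h2 := TopRank.regret_le_sqrt hA hα hu fallback hδ hδ1 hn
    exact ⟨by linarith, by linarith⟩
  · refine ⟨32, by norm_num, fun L K hKL => ?_⟩
    have hev : ∀ᶠ n : ℕ in Filter.atTop, 3 ≤ n ∧ TopRank.c ≤ n ∧ (K : ℝ) * L ^ 2 ≤ Real.log n :=
      (Filter.eventually_ge_atTop 3).and
        ((tendsto_natCast_atTop_atTop.eventually_ge_atTop TopRank.c).and
          ((Real.tendsto_log_atTop.comp tendsto_natCast_atTop_atTop).eventually_ge_atTop _))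
    obtain ⟨n₀, hn₀⟩ := Filter.eventually_atTop.1 hev
    refine ⟨n₀, fun n hn α v hA hα user hu fallback => ?_⟩
    obtain ⟨h3, hc, hlog⟩ := hn₀ n hn
    exact ⟨TopRank.regret_le_gap_log hA hα hu fallback h3 hc hlog,
      TopRank.regret_le_sqrt_log hA hα hu fallback hKL h3 hc hlog⟩
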